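/- Let $\Phi:[0,\infty)\to[0,\infty)$ be a convex growth function (that is, $\Phi$ is convex, continuous, nondecreasing and maps $[0,\infty)$ onto itself) such that $\Phi(t)>0$ for all $t>0$. For measurable $f:\mathbb{R}\to\mathbb{C}$ put $$\|f\|_{L^\Phi}^{lux}=\inf\Big\{\lambda>0:\int_{\mathbb{R}}\Phi\Big(\frac{|f(x)|}{\lambda}\Big)dx\le 1\Big\},$$ and let $h^\Phi(\mathbb{C}_+)$ be the set of complex-valued harmonic functions $F$ on the upper half-plane $\mathbb{C}_+=\{x+iy: y>0\}$ with $\sup_{y>0}\|F(\cdot+iy)\|_{L^\Phi}^{lux}<\infty$. A complex Borel measure on $\mathbb{R}$ is here a complex-valued set function, defined and countably additive on the bounded Borel subsets of $\mathbb{R}$ (its total mass may be infinite), and $|\mu|$ denotes its total variation. For every $F\in h^\Phi(\mathbb{C}_+)$ there exists a unique complex Borel measure $\mu$ on $\mathbb{R}$ such that $$\int_{\mathbb{R}}\frac{d|\mu|(t)}{1+t^2}<\infty\quad\text{and}\quad F(x+iy)=\frac1\pi\int_{\mathbb{R}}\frac{y}{(x-t)^2+y^2}\,d\mu(t)\quad\text{for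 all } x+iy\in\mathbb{C}_+.$$ Moreover, for this measure $\mu$, $$\lim_{y\to0^+}\int_{\mathbb{R}}\varphi(x)F(x+iy)\,dx=\int_{\mathbb{R}}\varphi(x)\,d\mu(x)\quad\text{for every continuous } \varphi:\mathbb{R}\to\mathbb{C}\text{ with compact support.}$$ -/

import Mathlib

open MeasureTheory Filter Topology Set
open scoped ENNReal Function

noncomputable section

/-- A growth function: a continuous nondecreasing function from `[0, ∞)` onto itself
(the values of `Φ` on the negative half-line are irrelevant). -/
structure IsGrowthFunction (Φ : ℝ → ℝ) : Prop where
  continuousOn : ContinuousOn Φ (Ici 0)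
  monotoneOn : MonotoneOn Φ (Ici 0)
  image_eq : Φ '' Ici 0 = Ici 0

/-- The Luxemburg functional `inf {l > 0 : ∫ Φ(|f(x)| / l) dx ≤ 1}` of `f : ℝ → ℂ`, as an extended
nonnegative real (it is `∞` when no such `l` exists). -/
def luxemburgNorm (Φ : ℝ → ℝ) (f : ℝ → ℂ) : ℝ≥0∞ :=
  ⨅ (l : ℝ) (_ : 0 < l) (_ : ∫⁻ x : ℝ, ENNReal.ofReal (Φ (‖f x‖ / l)) ≤ 1), ENNReal.ofReal l

/-- `F` belongs to the Hardy-Orlicz space of harmonic functions on the upper half-plane: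
`F` is harmonic on `{z | 0 < Im z}` and the Luxemburg norms of its restrictions to horizontal
lines are bounded. -/
structure MemHardyOrlicz (Φ : ℝ → ℝ) (F : ℂ → ℂ) : Prop where
  harmonic : InnerProductSpace.HarmonicOnNhd F {z : ℂ | 0 < z.im}
  bounded : ⨆ (y : ℝ) (_ : 0 < y), luxemburgNorm Φ (fun x : ℝ => F (x + y * Complex.I)) < ∞

/-- A complex Borel measure on `ℝ`, not necessarily of finite total mass: a complex-valued set
function on the bounded Borel sets which is countably additive there. As a total function it is
given the value `0` on all other sets, so that two of them are equal as soon as they agree on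
the bounded Borel sets. -/
@[ext]
structure BorelComplexMeasure where
  toFun : Set ℝ → ℂ
  apply_eq_zero : ∀ s : Set ℝ, ¬ (MeasurableSet s ∧ Bornology.IsBounded s) → toFun s = 0
  hasSum_iUnion : ∀ s : ℕ → Set ℝ, (∀ n, MeasurableSet (s n)) → Pairwise (Disjoint on s) →
    Bornology.IsBounded (⋃ n, s n) → HasSum (fun n => toFun (s n)) (toFun (⋃ n, s n))

namespace BorelComplexMeasure

variable (μ : BorelComplexMeasure)

theorem apply_empty : μ.toFun ∅ = 0 := by
  have h := μ.hasSum_iUnion (fun _ => ∅) (fun _ => MeasurableSet.empty)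
    (fun _ _ _ => by simp [Function.onFun]) (by simp)
  have h2 := h.summable.tendsto_atTop_zero
  exact tendsto_nhds_unique tendsto_const_nhds h2

theorem isSigmaSubadditive_enorm : IsSigmaSubadditiveSetFun (fun s => ‖μ.toFun s‖ₑ) := by
  intro s hs
  by_cases hb : Bornology.IsBounded (⋃ n, (s n).val)
  · have h := μ.hasSum_iUnion (fun n => (s n).val) (fun n => (s n).prop) hs hb
    simp only [← h.tsum_eq]
    exact enorm_tsum_le_tsum_enorm
  · simp [μ.apply_eq_zero _ (fun h => hb h.2)]

/-- The total variation `|μ|`, a positive Borel measure: `|μ|(E)` is the supremum over the finite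
measurable partitions `(Eᵢ)` of `E` of `∑ |μ(Eᵢ)|` (in which the unbounded pieces count as `0`). -/
def variation : Measure ℝ :=
  preVariation (fun s => ‖μ.toFun s‖ₑ) μ.isSigmaSubadditive_enorm (by simp [μ.apply_empty])

open scoped Classical in
/-- The finite complex measure `s ↦ μ(s ∩ [-n, n])`. -/
def trunc (n : ℕ) : ComplexMeasure ℝ where
  measureOf' s := if MeasurableSet s then μ.toFun (s ∩ Icc (-n : ℝ) n) else 0
  empty' := by simp [μ.apply_empty]
  not_measurable' s hs := by simp [hs]
  m_iUnion' s hs hd := by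
    simp only [hs, MeasurableSet.iUnion hs, if_true, iUnion_inter]
    refine μ.hasSum_iUnion _ (fun n => (hs n).inter measurableSet_Icc) ?_ ?_
    · exact fun i j hij => (hd hij).mono inter_subset_left inter_subset_left
    · rw [← iUnion_inter]
      exact (Metric.isBounded_Icc _ _).subset inter_subset_right

open scoped Classical in
/-- The integral `∫ f dμ` of a `|μ|`-integrable function `f`: the limit of the integrals of `f`
against the finite complex measures `s ↦ μ(s ∩ [-n, n])`. It is `0` if `f` is not
`|μ|`-integrable. -/
def integral (f : ℝ → ℂ) : ℂ :=
  if Integrable f μ.variation then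
    limUnder atTop (fun n : ℕ => (μ.trunc n).integral f (ContinuousLinearMap.mul ℝ ℂ))
  else 0

end BorelComplexMeasure

/-- `∫ d|μ|(t) / (1 + t²) < ∞` and `F` is the Poisson integral of `μ` on the upper half-plane. -/
structure IsPoissonIntegralOf (F : ℂ → ℂ) (μ : BorelComplexMeasure) : Prop where
  lintegral_lt_top : ∫⁻ t : ℝ, ENNReal.ofReal (1 / (1 + t ^ 2)) ∂μ.variation < ∞
  eq_integral : ∀ x y : ℝ, 0 < y → F (x + y * Complex.I) =
    1 / (Real.pi : ℂ) * μ.integral (fun t : ℝ => ((y / ((x - t) ^ 2 + y ^ 2) : ℝ) : ℂ))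

end

/-!
The proof goes from a growth condition on horizontal lines to a bound, from there to a Poisson
representation on smaller half-planes, and then to a weak limit.

* Convexity gives `t * Φ 1 ≤ Φ 1 + Φ t`, so a function in the Hardy–Orlicz space has uniformly
  bounded integrals `∫ w(x) |F(x + iy)| dx` for every integrable weight `w ≤ 1`
  (`MemHardyOrlicz.exists_lintegral_mul_enorm_le`). Averaging over discs of a fixed radius bounds
  `F` on each half-plane `Im z ≥ ε` (`MemHardyOrlicz.exists_norm_le`).

* A bounded harmonic function on a neighbourhood of the closed half-plane is the Poisson integral
  of its boundary values (`eq_integral_halfPlaneKernel_mul`): this is the limit of the Poisson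
  formula for the discs of radius `R` that touch the real line at the origin, as `R → ∞`. Applied
  to `z ↦ F (z + iε)` it represents `F (x + i(y + ε))` by the density `F(t + iε) dt`.

* With the weight `w(t) = (1 + |t|) ^ (-3/2)`, the integrals of `w |F(· + iε)|` are bounded, so the
  measures `F(t + iε) dt` converge along an ultrafilter `ε → 0` to a complex measure `μ`
  (`exists_borelComplexMeasure_tendsto`, by the Riesz–Markov–Kakutani theorem applied to the
  positive and negative parts). The Poisson kernel decays faster than `w`, so no mass escapes to
  infinity and the representation passes to the limit.

* For the limit at the boundary, write `μ = h d|μ|` with `h` bounded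
  (`BorelComplexMeasure.exists_hasDensity`), so that integrals against `μ` become integrals against
  a positive measure (`BorelComplexMeasure.HasDensity.integral_eq`). Fubini moves the Poisson
  kernel to the test function, whose Poisson integrals converge to it under the common majorant
  `D / (1 + t ^ 2)` (`IsPoissonIntegralOf.tendsto_integral_mul`). The limit determines `μ`, which is
  the uniqueness.
-/

/-! ### Complex measures with a bounded density -/

namespace BorelComplexMeasure

/-- The bound `|μ(s)| ≤ |μ|(s)`. It holds for unbounded `s` as well, where `μ.toFun s = 0`. -/
theorem enorm_toFun_le_variation (μ : BorelComplexMeasure) {s : Set ℝ} (hs : MeasurableSet s) :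
    ‖μ.toFun s‖ₑ ≤ μ.variation s := by
  by_cases hs' : (⟨s, hs⟩ : Subtype MeasurableSet) = ⊥
  · have : s = ∅ := congrArg Subtype.val hs'
    simp [this, μ.apply_empty]
  simp only [variation, preVariation, VectorMeasure.ennrealToMeasure_apply hs,
    ennrealPreVariation_apply]
  calc ‖μ.toFun s‖ₑ
      = ∑ p ∈ (Finpartition.indiscrete hs').parts, ‖μ.toFun p‖ₑ := by simp
    _ ≤ preVariationFun (‖μ.toFun ·‖ₑ) s := by apply preVariation.sum_le

/-- The variation is the least positive measure dominating the set function. -/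
theorem variation_le_of_forall_enorm_le {μ : BorelComplexMeasure} {m : Measure ℝ}
    (h : ∀ s, MeasurableSet s → ‖μ.toFun s‖ₑ ≤ m s) : μ.variation ≤ m := by
  refine Measure.le_intro fun s hs _ => ?_
  simp only [variation, preVariation, VectorMeasure.ennrealToMeasure_apply hs,
    ennrealPreVariation_apply, preVariationFun, hs, dite_true, iSup_le_iff]
  intro P
  calc ∑ x ∈ P.parts, ‖μ.toFun x‖ₑ
      ≤ ∑ x ∈ P.parts, m x := Finset.sum_le_sum fun t _ => h t t.property
    _ = m (P.parts.sup Subtype.val) := by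
      rw [Finset.sup_set_eq_biUnion]
      refine (measure_biUnion_finset ?_ fun b _ => b.property).symm
      intro a ha b hb hab
      simpa [disjoint_iff, Subtype.ext_iff] using P.disjoint ha hb hab
    _ ≤ m s := by
      rw [Finset.sup_set_eq_biUnion]
      exact measure_mono <| Set.iUnion₂_subset fun _ hp => Subtype.coe_le_coe.mpr (P.le hp)

theorem trunc_apply (μ : BorelComplexMeasure) (n : ℕ) {s : Set ℝ} (hs : MeasurableSet s) :
    μ.trunc n s = μ.toFun (s ∩ Icc (-n : ℝ) n) :=
  if_pos hs

/-- The complex measure `μ` is `h dρ`: it has the essentially bounded density `h` with respect to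
the positive measure `ρ`. -/
structure HasDensity (μ : BorelComplexMeasure) (ρ : Measure ℝ) (h : ℝ → ℂ) : Prop where
  aestronglyMeasurable : AEStronglyMeasurable h ρ
  bounded : ∃ C : ℝ, ∀ᵐ x ∂ρ, ‖h x‖ ≤ C
  apply_eq : ∀ s, MeasurableSet s → Bornology.IsBounded s → μ.toFun s = ∫ x in s, h x ∂ρ

namespace HasDensity

variable {μ : BorelComplexMeasure} {ρ : Measure ℝ} {h : ℝ → ℂ}

theorem integrable_mul (H : μ.HasDensity ρ h) {f : ℝ → ℂ} (hf : Integrable f ρ) :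
    Integrable (fun x => f x * h x) ρ := by
  obtain ⟨C, hC⟩ := H.bounded
  exact hf.mul_bdd H.aestronglyMeasurable hC

theorem exists_variation_le (H : μ.HasDensity ρ h) : ∃ C : NNReal, μ.variation ≤ C • ρ := by
  obtain ⟨C, hC⟩ := H.bounded
  refine ⟨C.toNNReal, variation_le_of_forall_enorm_le fun s hs => ?_⟩
  by_cases hb : Bornology.IsBounded s
  · rw [H.apply_eq s hs hb]
    calc ‖∫ x in s, h x ∂ρ‖ₑ ≤ ∫⁻ x in s, ‖h x‖ₑ ∂ρ := enorm_integral_le_lintegral_enorm _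
      _ ≤ ∫⁻ _ in s, (C.toNNReal : ℝ≥0∞) ∂ρ := by
        refine lintegral_mono_ae (ae_restrict_of_ae (hC.mono fun x hx => ?_))
        rw [← ofReal_norm]
        exact ENNReal.ofReal_le_ofReal hx
      _ = (C.toNNReal • ρ) s := setLIntegral_const _ _
  · simp [μ.apply_eq_zero s (fun h => hb h.2)]

variable [IsLocallyFiniteMeasure ρ]

theorem integrableOn (H : μ.HasDensity ρ h) {s : Set ℝ} (hb : Bornology.IsBounded s) :
    IntegrableOn h s ρ := by
  obtain ⟨C, hC⟩ := H.bounded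
  obtain ⟨R, hR⟩ := hb.subset_closedBall 0
  have h1 : IntegrableOn (fun _ => (1 : ℂ)) s ρ :=
    integrableOn_const ((measure_mono hR).trans_lt (isCompact_closedBall _ _).measure_lt_top).ne
  have := h1.mul_bdd H.aestronglyMeasurable.restrict (ae_restrict_of_ae hC)
  simpa only [one_mul, IntegrableOn] using this

theorem trunc_eq (H : μ.HasDensity ρ h) (n : ℕ) :
    μ.trunc n = (ρ.restrict (Icc (-n : ℝ) n)).withDensityᵥ h := by
  ext s hs : 1
  rw [withDensityᵥ_apply (H.integrableOn (Metric.isBounded_Icc _ _)) hs, trunc_apply _ _ hs,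
    Measure.restrict_restrict hs]
  exact H.apply_eq _ (hs.inter measurableSet_Icc) ((Metric.isBounded_Icc _ _).subset
    inter_subset_right)

end HasDensity

end BorelComplexMeasure

/-- Integrating `f` against the vector measure `h dρ` amounts to integrating `f h` against `ρ`. Both
sides are additive and continuous for the `L¹(ρ)` distance, so indicators suffice. -/
theorem integral_withDensityᵥ_mul {ρ : Measure ℝ} [IsFiniteMeasure ρ] {h : ℝ → ℂ} {C : ℝ}
    (hm : AEStronglyMeasurable h ρ) (hC : ∀ᵐ x ∂ρ, ‖h x‖ ≤ C) {f : ℝ → ℂ} (hf : Integrable f ρ) :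
    (ρ.withDensityᵥ h).integral f (ContinuousLinearMap.mul ℝ ℂ) = ∫ x, f x * h x ∂ρ := by
  have hh : Integrable h ρ := by
    simpa using (integrable_const (1 : ℂ) : Integrable _ ρ).mul_bdd hm hC
  have hle : (ρ.withDensityᵥ h).variation ≤ C.toNNReal • ρ := by
    rw [Measure.variation_withDensityᵥ hh]
    refine Measure.le_iff.2 fun s hs => ?_
    rw [withDensity_apply _ hs]
    calc ∫⁻ x in s, ‖h x‖ₑ ∂ρ ≤ ∫⁻ _ in s, (C.toNNReal : ℝ≥0∞) ∂ρ := by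
          refine lintegral_mono_ae (ae_restrict_of_ae (hC.mono fun x hx => ?_))
          rw [← ofReal_norm]
          exact ENNReal.ofReal_le_ofReal hx
      _ = (C.toNNReal • ρ) s := setLIntegral_const _ _
  have hint : ∀ {f : ℝ → ℂ}, Integrable f ρ → Integrable f (ρ.withDensityᵥ h).variation :=
    fun hf => (hf.smul_measure_nnreal (c := C.toNNReal)).mono_measure hle
  have hac : (ρ.withDensityᵥ h).variation ≪ ρ := Measure.absolutelyContinuous_of_le_smul hle
  refine Integrable.induction (fun f => (ρ.withDensityᵥ h).integral f (ContinuousLinearMap.mul ℝ ℂ)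
    = ∫ x, f x * h x ∂ρ) ?_ ?_ ?_ ?_ hf
  · intro c s hs _
    have : IsFiniteMeasure (ρ.withDensityᵥ h).variation := isFiniteMeasure_of_le _ hle
    rw [VectorMeasure.integral_eq_setToFun, setToFun_indicator_const _ hs (measure_ne_top _ _)]
    rw [transpose_eq_cbmApplyMeasure, cbmApplyMeasure_apply,
      withDensityᵥ_apply hh hs]
    have : (fun x => s.indicator (fun _ => c) x * h x) = s.indicator fun x => c * h x := by
      ext x; by_cases hx : x ∈ s <;> simp [hx]
    rw [this, integral_indicator hs, integral_const_mul]
    simp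
  · intro f g _ hf hg ihf ihg
    have := VectorMeasure.integral_fun_add (B := ContinuousLinearMap.mul ℝ ℂ) (hint hf) (hint hg)
    have e : (f + g) = fun x => f x + g x := rfl
    rw [e, this, ihf, ihg, ← integral_add (hf.mul_bdd hm hC) (hg.mul_bdd hm hC)]
    simp only [add_mul]
  · refine isClosed_eq ?_ ?_
    · refine continuous_iff_continuousAt.2 fun f => ?_
      refine VectorMeasure.tendsto_integral_of_L1 _ (hint (L1.integrable_coeFn f)).1
        (Eventually.of_forall fun g => hint (L1.integrable_coeFn g)) ?_
      have h0 : Tendsto (fun g : ℝ →₁[ρ] ℂ => (C.toNNReal : ℝ≥0∞) * edist g f) (𝓝 f) (𝓝 0) := by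
        have := ENNReal.Tendsto.const_mul (a := (C.toNNReal : ℝ≥0∞))
          (tendsto_iff_edist_tendsto_0.1 (tendsto_id (α := ℝ →₁[ρ] ℂ) (x := 𝓝 f)))
          (Or.inr ENNReal.coe_ne_top)
        simpa using this
      refine tendsto_of_tendsto_of_tendsto_of_le_of_le tendsto_const_nhds h0
        (fun _ => zero_le) fun g => ?_
      calc ∫⁻ x, ‖g x - f x‖ₑ ∂(ρ.withDensityᵥ h).variation
          ≤ ∫⁻ x, ‖g x - f x‖ₑ ∂(C.toNNReal • ρ) := lintegral_mono' hle le_rfl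
        _ = C.toNNReal * edist g f := by
          rw [lintegral_smul_measure, L1.edist_def]
          simp [edist_eq_enorm_sub, ENNReal.smul_def]
    · refine continuous_iff_continuousAt.2 fun f => ?_
      refine tendsto_integral_of_L1 _ ((L1.integrable_coeFn f).mul_bdd hm hC).1
        (Eventually.of_forall fun g => (L1.integrable_coeFn g).mul_bdd hm hC) ?_
      have h0 : Tendsto (fun g : ℝ →₁[ρ] ℂ => edist g f * (C.toNNReal : ℝ≥0∞)) (𝓝 f) (𝓝 0) := by
        have := ENNReal.Tendsto.mul_const (b := (C.toNNReal : ℝ≥0∞))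
          (tendsto_iff_edist_tendsto_0.1 (tendsto_id (α := ℝ →₁[ρ] ℂ) (x := 𝓝 f)))
          (Or.inr ENNReal.coe_ne_top)
        simpa using this
      refine tendsto_of_tendsto_of_tendsto_of_le_of_le tendsto_const_nhds h0
        (fun _ => zero_le) fun g => ?_
      calc ∫⁻ x, ‖g x * h x - f x * h x‖ₑ ∂ρ
          ≤ ∫⁻ x, ‖g x - f x‖ₑ * C.toNNReal ∂ρ := by
            refine lintegral_mono_ae (hC.mono fun x hx => ?_)
            rw [← sub_mul, enorm_mul]
            gcongr
            rw [← ofReal_norm]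
            exact ENNReal.ofReal_le_ofReal hx
        _ = edist g f * C.toNNReal := by
          rw [lintegral_mul_const' _ _ ENNReal.coe_ne_top, L1.edist_def]
          simp [edist_eq_enorm_sub]
  · intro f g hfg hf ih
    rw [← VectorMeasure.integral_congr_ae (hac hfg), ih]
    exact integral_congr_ae (hfg.mono fun x hx => by simp [hx])

namespace BorelComplexMeasure

/-- Integrals against a complex measure with a bounded density are integrals against the positive
measure; the limit over truncations in the definition is a limit over the intervals `[-n, n]`. -/
theorem HasDensity.integral_eq {μ : BorelComplexMeasure} {ρ : Measure ℝ} {h : ℝ → ℂ}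
    [IsLocallyFiniteMeasure ρ] (H : μ.HasDensity ρ h) {f : ℝ → ℂ} (hf : Integrable f ρ) :
    μ.integral f = ∫ x, f x * h x ∂ρ := by
  obtain ⟨C, hle⟩ := H.exists_variation_le
  have hfv : Integrable f μ.variation := (hf.smul_measure_nnreal (c := C)).mono_measure hle
  rw [integral, if_pos hfv]
  refine Tendsto.limUnder_eq ?_
  obtain ⟨D, hD⟩ := H.bounded
  have e : ∀ n : ℕ, (μ.trunc n).integral f (ContinuousLinearMap.mul ℝ ℂ) =
      ∫ x in Icc (-n : ℝ) n, f x * h x ∂ρ := fun n => by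
    have : IsFiniteMeasure (ρ.restrict (Icc (-n : ℝ) n)) :=
      ⟨by simpa using isCompact_Icc.measure_lt_top⟩
    rw [H.trunc_eq]
    exact integral_withDensityᵥ_mul H.aestronglyMeasurable.restrict (ae_restrict_of_ae hD)
      hf.restrict
  simp only [e]
  have hU : ⋃ n : ℕ, Icc (-n : ℝ) n = univ := by
    refine eq_univ_of_forall fun x => mem_iUnion.2 ?_
    obtain ⟨n, hn⟩ := exists_nat_ge |x|
    exact ⟨n, abs_le.1 hn⟩
  have := tendsto_setIntegral_of_monotone (μ := ρ) (f := fun x => f x * h x)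
    (s := fun n : ℕ => Icc (-n : ℝ) n) (fun _ => measurableSet_Icc)
    (fun m n hmn => Icc_subset_Icc (by simpa using hmn) (by simpa using hmn))
    (H.integrable_mul hf).integrableOn
  rwa [hU, Measure.restrict_univ] at this

end BorelComplexMeasure

/-! ### Existence of densities, and measures as functionals -/

/-- The Radon–Nikodym theorem for a complex measure whose total variation is at most the finite
measure `ρ`: the density is bounded by one. -/
theorem MeasureTheory.ComplexMeasure.exists_withDensityᵥ_eq {c : ComplexMeasure ℝ} {ρ : Measure ℝ}
    [IsFiniteMeasure ρ] (hc : c.variation ≤ ρ) :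
    ∃ h : ℝ → ℂ, Measurable h ∧ (∀ᵐ x ∂ρ, ‖h x‖ ≤ 1) ∧ ρ.withDensityᵥ h = c := by
  -- The real and imaginary parts are signed measures, which have Radon–Nikodym derivatives.
  have hac : c ≪ᵥ ρ.toENNRealVectorMeasure := by
    refine VectorMeasure.AbsolutelyContinuous.mk fun s hs h0 => ?_
    rw [Measure.toENNRealVectorMeasure_apply_measurable hs] at h0
    have := (VectorMeasure.enorm_measure_le_variation c s).trans ((hc s).trans h0.le)
    simpa using this
  obtain ⟨hre, him⟩ := (ComplexMeasure.absolutelyContinuous_ennreal_iff _ _).1 hac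
  have hR := SignedMeasure.withDensityᵥ_rnDeriv_eq _ _ hre
  have hI := SignedMeasure.withDensityᵥ_rnDeriv_eq _ _ him
  have hint := c.integrable_rnDeriv ρ
  have heq : ρ.withDensityᵥ (c.rnDeriv ρ) = c := by
    ext s hs : 1
    rw [withDensityᵥ_apply hint hs]
    apply Complex.ext
    · have := congrArg (fun m => m s) hR
      simp only [withDensityᵥ_apply (SignedMeasure.integrable_rnDeriv _ _) hs] at this
      rw [← RCLike.re_eq_complex_re, ← integral_re hint.integrableOn]
      exact this
    · have := congrArg (fun m => m s) hI
      simp only [withDensityᵥ_apply (SignedMeasure.integrable_rnDeriv _ _) hs] at this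
      rw [← RCLike.im_eq_complex_im, ← integral_im hint.integrableOn]
      exact this
  have hm : Measurable (c.rnDeriv ρ) :=
    Complex.measurableEquivRealProd.symm.measurable.comp
      ((SignedMeasure.measurable_rnDeriv _ _).prodMk (SignedMeasure.measurable_rnDeriv _ _))
  refine ⟨c.rnDeriv ρ, hm, ?_, heq⟩
  rw [← heq, Measure.variation_withDensityᵥ hint] at hc
  have := ae_le_of_forall_setLIntegral_le_of_sigmaFinite (μ := ρ) (g := fun _ => 1) hm.enorm
    fun s hs _ => by
      rw [setLIntegral_one, ← withDensity_apply _ hs]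
      exact hc s
  filter_upwards [this] with x hx
  rw [← ofReal_norm] at hx
  exact ENNReal.ofReal_le_one.1 hx

namespace BorelComplexMeasure

/-- A complex measure whose variation is dominated by a locally finite measure `ρ` has a density
with respect to `ρ`. The densities of its truncations are glued along the sets `⌈|x|⌉ = k`. -/
theorem exists_hasDensity {μ : BorelComplexMeasure} {ρ : Measure ℝ} [IsLocallyFiniteMeasure ρ]
    (hle : μ.variation ≤ ρ) : ∃ h : ℝ → ℂ, μ.HasDensity ρ h := by
  have hfin : ∀ k : ℕ, IsFiniteMeasure (ρ.restrict (Icc (-k : ℝ) k)) := fun k =>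
    ⟨by simpa using isCompact_Icc.measure_lt_top⟩
  have hvar : ∀ k : ℕ, (μ.trunc k).variation ≤ ρ.restrict (Icc (-k : ℝ) k) := fun k =>
    VectorMeasure.variation_le_of_forall_enorm_le fun s hs => by
      rw [trunc_apply _ _ hs, Measure.restrict_apply hs]
      exact (μ.enorm_toFun_le_variation (hs.inter measurableSet_Icc)).trans (hle _)
  choose H hHm hHb hH using fun k => ComplexMeasure.exists_withDensityᵥ_eq (hvar k)
  have hmemI : ∀ x : ℝ, x ∈ Icc (-(⌈|x|⌉₊ : ℝ)) ⌈|x|⌉₊ := fun x => abs_le.1 (Nat.le_ceil _)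
  have hceil : Measurable fun x : ℝ => ⌈|x|⌉₊ := Nat.measurable_ceil.comp measurable_norm
  have hm : Measurable fun x => H ⌈|x|⌉₊ x :=
    (measurable_from_prod_countable_right (f := fun p : ℕ × ℝ => H p.1 p.2) hHm).comp
      (hceil.prodMk measurable_id)
  have hb : ∀ᵐ x ∂ρ, ‖H ⌈|x|⌉₊ x‖ ≤ 1 := by
    have : ∀ᵐ x ∂ρ, ∀ k : ℕ, x ∈ Icc (-k : ℝ) k → ‖H k x‖ ≤ 1 :=
      ae_all_iff.2 fun k => (ae_restrict_iff' measurableSet_Icc).1 (hHb k)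
    exact this.mono fun x hx => hx _ (hmemI x)
  refine ⟨fun x => H ⌈|x|⌉₊ x, hm.aestronglyMeasurable, ⟨1, hb⟩, fun s hs hsb => ?_⟩
  set A : ℕ → Set ℝ := fun k => s ∩ {x | ⌈|x|⌉₊ = k} with hA
  have hAm : ∀ k, MeasurableSet (A k) := fun k => hs.inter (hceil (measurableSet_singleton k))
  have hAd : Pairwise (Disjoint on A) := fun i j hij => by
    refine Set.disjoint_left.2 fun x hx hx' => hij ?_
    rw [← hx.2, ← hx'.2]
  have hAU : ⋃ k, A k = s := by
    rw [hA, ← inter_iUnion, inter_eq_left]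
    exact fun x _ => mem_iUnion.2 ⟨_, rfl⟩
  have hAI : ∀ k, A k ⊆ Icc (-k : ℝ) k := fun k x hx => by
    have := hmemI x
    rwa [show ⌈|x|⌉₊ = k from hx.2] at this
  have hint : IntegrableOn (fun x => H ⌈|x|⌉₊ x) (⋃ k, A k) ρ := by
    rw [hAU]
    obtain ⟨R, hR⟩ := hsb.subset_closedBall 0
    have h1 : IntegrableOn (fun _ => (1 : ℂ)) s ρ :=
      integrableOn_const ((measure_mono hR).trans_lt (isCompact_closedBall _ _).measure_lt_top).ne
    have := h1.mul_bdd hm.aestronglyMeasurable.restrict (ae_restrict_of_ae hb)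
    simpa only [one_mul, IntegrableOn] using this
  have h1 := hasSum_integral_iUnion hAm hAd hint
  have h2 := μ.hasSum_iUnion A hAm hAd (by rwa [hAU])
  rw [hAU] at h1 h2
  suffices e : ∀ k, μ.toFun (A k) = ∫ x in A k, H ⌈|x|⌉₊ x ∂ρ from
    h2.unique (by simpa only [e] using h1)
  intro k
  calc μ.toFun (A k) = μ.trunc k (A k) := by
        rw [trunc_apply _ _ (hAm k), inter_eq_left.2 (hAI k)]
    _ = ∫ x in A k, H k x ∂ρ.restrict (Icc (-k : ℝ) k) := by
      rw [← hH k, withDensityᵥ_apply _ (hAm k)]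
      have h1 : Integrable (fun _ => (1 : ℂ)) (ρ.restrict (Icc (-k : ℝ) k)) := integrable_const _
      simpa only [one_mul] using h1.mul_bdd (hHm k).aestronglyMeasurable (hHb k)
    _ = ∫ x in A k, H k x ∂ρ := by
      rw [Measure.restrict_restrict (hAm k), inter_eq_left.2 (hAI k)]
    _ = ∫ x in A k, H ⌈|x|⌉₊ x ∂ρ :=
      setIntegral_congr_fun (hAm k) fun x hx => by
        simp only [show ⌈|x|⌉₊ = k from hx.2]

open scoped Classical in
/-- The complex measure `h dρ`, for `h` locally integrable with respect to `ρ`. -/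
noncomputable def ofDensity (ρ : Measure ℝ) (h : ℝ → ℂ) (hh : LocallyIntegrable h ρ) :
    BorelComplexMeasure where
  toFun s := if MeasurableSet s ∧ Bornology.IsBounded s then ∫ x in s, h x ∂ρ else 0
  apply_eq_zero s hs := if_neg hs
  hasSum_iUnion s hs hd hb := by
    have hbn : ∀ n, Bornology.IsBounded (s n) := fun n => hb.subset (subset_iUnion s n)
    simp only [hs, hbn, hb, MeasurableSet.iUnion hs, and_self, if_true]
    obtain ⟨R, hR⟩ := hb.subset_closedBall 0
    exact hasSum_integral_iUnion hs hd
      ((hh.integrableOn_isCompact (isCompact_closedBall _ _)).mono_set hR)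

theorem hasDensity_ofDensity {ρ : Measure ℝ} {h : ℝ → ℂ} (hh : LocallyIntegrable h ρ) {C : ℝ}
    (hC : ∀ᵐ x ∂ρ, ‖h x‖ ≤ C) : (ofDensity ρ h hh).HasDensity ρ h :=
  ⟨hh.aestronglyMeasurable, ⟨C, hC⟩, fun _ hs hb => if_pos ⟨hs, hb⟩⟩

theorem HasDensity.locallyIntegrable {μ : BorelComplexMeasure} {ρ : Measure ℝ}
    [IsLocallyFiniteMeasure ρ] {h : ℝ → ℂ} (H : μ.HasDensity ρ h) : LocallyIntegrable h ρ :=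
  locallyIntegrable_iff.2 fun _ hK => H.integrableOn hK.isBounded

/-- Two complex measures of locally finite variation agree as soon as they integrate all continuous
functions of compact support to the same value. -/
theorem eq_of_forall_integral_eq {μ ν : BorelComplexMeasure} [IsLocallyFiniteMeasure μ.variation]
    [IsLocallyFiniteMeasure ν.variation]
    (h : ∀ φ : ℝ → ℂ, Continuous φ → HasCompactSupport φ → μ.integral φ = ν.integral φ) :
    μ = ν := by
  -- Both measures have densities with respect to the sum of their variations; the densities agree
  -- because they have the same integrals against smooth functions of compact support.
  set ρ := μ.variation + ν.variation with hρ
  have : IsLocallyFiniteMeasure ρ := by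
    refine ⟨fun x => ?_⟩
    obtain ⟨s, hs, hs'⟩ := μ.variation.finiteAt_nhds x
    obtain ⟨t, ht, ht'⟩ := ν.variation.finiteAt_nhds x
    refine ⟨s ∩ t, inter_mem hs ht, ?_⟩
    rw [hρ, Measure.add_apply]
    exact ENNReal.add_lt_top.2 ⟨(measure_mono inter_subset_left).trans_lt hs',
      (measure_mono inter_subset_right).trans_lt ht'⟩
  obtain ⟨f, hf⟩ := exists_hasDensity (μ := μ) (ρ := ρ) (Measure.le_add_right le_rfl)
  obtain ⟨g, hg⟩ := exists_hasDensity (μ := ν) (ρ := ρ) (Measure.le_add_left le_rfl)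
  have hfg : ∀ᵐ x ∂ρ, f x - g x = 0 := by
    refine ae_eq_zero_of_integral_contDiff_smul_eq_zero
      (hf.locallyIntegrable.sub hg.locallyIntegrable) fun φ hφ hφs => ?_
    have hc : Continuous fun x => (φ x : ℂ) := Complex.continuous_ofReal.comp hφ.continuous
    have hcs : HasCompactSupport fun x => (φ x : ℂ) := hφs.comp_left Complex.ofReal_zero
    have hint : Integrable (fun x => (φ x : ℂ)) ρ := hc.integrable_of_hasCompactSupport hcs
    have := h _ hc hcs
    rw [hf.integral_eq hint, hg.integral_eq hint, ← sub_eq_zero,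
      ← integral_sub (hf.integrable_mul hint) (hg.integrable_mul hint)] at this
    simpa [mul_sub] using this
  ext s
  by_cases hs : MeasurableSet s ∧ Bornology.IsBounded s
  · rw [hf.apply_eq s hs.1 hs.2, hg.apply_eq s hs.1 hs.2]
    exact integral_congr_ae (ae_restrict_of_ae (hfg.mono fun x hx => sub_eq_zero.1 hx))
  · rw [μ.apply_eq_zero s hs, ν.apply_eq_zero s hs]

end BorelComplexMeasure

/-! ### The Poisson kernel and boundary limits of Poisson integrals -/

/-- The kernel `y / ((x - t)² + y²)` of the upper half-plane. -/
noncomputable def halfPlaneKernel (x y t : ℝ) : ℝ := y / ((x - t) ^ 2 + y ^ 2)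

theorem continuous_halfPlaneKernel {y : ℝ} (hy : 0 < y) :
    Continuous fun p : ℝ × ℝ => halfPlaneKernel p.1 y p.2 := by
  unfold halfPlaneKernel
  exact continuous_const.div (by fun_prop) fun p => by positivity

theorem halfPlaneKernel_nonneg (x : ℝ) {y : ℝ} (hy : 0 < y) (t : ℝ) :
    0 ≤ halfPlaneKernel x y t := by
  unfold halfPlaneKernel; positivity

/-- For `x` in a bounded set and fixed height, the kernel is `O(1 / (1 + t²))`. -/
theorem halfPlaneKernel_le {x y R : ℝ} (hy : 0 < y) (hx : |x| ≤ R) (t : ℝ) :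
    halfPlaneKernel x y t ≤ y * (2 + (1 + 2 * R ^ 2) / y ^ 2) * (1 / (1 + t ^ 2)) := by
  have hx2 : x ^ 2 ≤ R ^ 2 := sq_le_sq' (abs_le.1 hx).1 (abs_le.1 hx).2
  have h1 : 1 + t ^ 2 ≤ (2 + (1 + 2 * R ^ 2) / y ^ 2) * ((x - t) ^ 2 + y ^ 2) := by
    have e : (2 + (1 + 2 * R ^ 2) / y ^ 2) * ((x - t) ^ 2 + y ^ 2) = 2 * (x - t) ^ 2 + 2 * y ^ 2
        + (1 + 2 * R ^ 2) / y ^ 2 * (x - t) ^ 2 + (1 + 2 * R ^ 2) := by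
      field_simp
      ring
    have h0 : 0 ≤ (1 + 2 * R ^ 2) / y ^ 2 * (x - t) ^ 2 := by positivity
    rw [e]
    nlinarith [sq_nonneg (2 * x - t), sq_nonneg y]
  unfold halfPlaneKernel
  rw [div_le_iff₀ (by positivity)]
  have h2 : (1 : ℝ) ≤ (2 + (1 + 2 * R ^ 2) / y ^ 2) * ((x - t) ^ 2 + y ^ 2) * (1 / (1 + t ^ 2)) := by
    rw [mul_one_div, le_div_iff₀ (by positivity)]
    linarith
  calc y = y * 1 := (mul_one y).symm
    _ ≤ y * ((2 + (1 + 2 * R ^ 2) / y ^ 2) * ((x - t) ^ 2 + y ^ 2) * (1 / (1 + t ^ 2))) := by gcongr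
    _ = _ := by ring

/-- The substitution `x = y u + t` turns the Poisson integral into an integral against the fixed
density `1 / (1 + u²)`. -/
theorem integral_mul_halfPlaneKernel (φ : ℝ → ℂ) {y : ℝ} (hy : 0 < y) (t : ℝ) :
    ∫ x, φ x * (halfPlaneKernel x y t : ℂ) = ∫ u, φ (y * u + t) * (((1 + u ^ 2)⁻¹ : ℝ) : ℂ) := by
  set g : ℝ → ℂ := fun x => φ (x + t) * (halfPlaneKernel (x + t) y t : ℂ)
  have h1 : ∫ x, φ x * (halfPlaneKernel x y t : ℂ) = ∫ x, g x :=
    (integral_add_right_eq_self (fun x => φ x * (halfPlaneKernel x y t : ℂ)) t).symm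
  have h2 := Measure.integral_comp_mul_left g y
  have h3 : ∫ x, g x = (y : ℂ) * ∫ u, g (y * u) := by
    have hy' : (y : ℂ) ≠ 0 := by exact_mod_cast hy.ne'
    rw [h2, abs_of_pos (inv_pos.2 hy), Complex.real_smul, ← mul_assoc]
    push_cast
    rw [mul_inv_cancel₀ hy', one_mul]
  rw [h1, h3, ← integral_const_mul]
  refine integral_congr_ae (Eventually.of_forall fun u => ?_)
  have e : y * halfPlaneKernel (y * u + t) y t = (1 + u ^ 2)⁻¹ := by
    have : (1 + u ^ 2) ≠ 0 := by positivity
    unfold halfPlaneKernel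
    rw [show (y * u + t - t) ^ 2 + y ^ 2 = y ^ 2 * (1 + u ^ 2) by ring]
    field_simp
  simp only [g, ← e]
  push_cast
  ring

theorem integrable_inv_one_add_sq_complex :
    Integrable fun u : ℝ => (((1 + u ^ 2)⁻¹ : ℝ) : ℂ) :=
  integrable_inv_one_add_sq.ofReal

/-- The Poisson integrals of a bounded continuous function converge to it pointwise at the
boundary. -/
theorem tendsto_integral_mul_halfPlaneKernel {φ : ℝ → ℂ} (hφ : Continuous φ) {M : ℝ}
    (hM : ∀ x, ‖φ x‖ ≤ M) (t : ℝ) :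
    Tendsto (fun y : ℝ => 1 / (Real.pi : ℂ) * ∫ x, φ x * (halfPlaneKernel x y t : ℂ)) (𝓝[>] 0)
      (𝓝 (φ t)) := by
  have h : Tendsto (fun y : ℝ => ∫ u, φ (y * u + t) * (((1 + u ^ 2)⁻¹ : ℝ) : ℂ)) (𝓝[>] 0)
      (𝓝 (∫ u, φ t * (((1 + u ^ 2)⁻¹ : ℝ) : ℂ))) := by
    refine tendsto_integral_filter_of_dominated_convergence (fun u => M * (1 + u ^ 2)⁻¹)
      (Eventually.of_forall fun y => ?_) (Eventually.of_forall fun y => ?_)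
      (integrable_inv_one_add_sq.const_mul M) (Eventually.of_forall fun u => ?_)
    · exact ((hφ.comp (by fun_prop)).aestronglyMeasurable).mul
        integrable_inv_one_add_sq_complex.aestronglyMeasurable
    · refine Eventually.of_forall fun u => ?_
      rw [norm_mul, Complex.norm_real, Real.norm_of_nonneg (by positivity)]
      gcongr
      exact hM _
    · refine Tendsto.mul_const _ (hφ.continuousAt.tendsto.comp ?_)
      have : Continuous fun y : ℝ => y * u + t := by fun_prop
      simpa using (this.tendsto 0).mono_left nhdsWithin_le_nhds
  have hpi : (Real.pi : ℂ) ≠ 0 := by exact_mod_cast Real.pi_ne_zero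
  have h2 := h.const_mul (1 / (Real.pi : ℂ))
  rw [integral_const_mul, integral_complex_ofReal, integral_univ_inv_one_add_sq,
    show 1 / (Real.pi : ℂ) * (φ t * Real.pi) = φ t by field_simp] at h2
  refine h2.congr' (eventually_mem_nhdsWithin.mono fun y hy => ?_)
  simp only
  rw [integral_mul_halfPlaneKernel φ hy]

/-- The Poisson integrals at height at most one of a continuous function of compact support have
the common majorant `D / (1 + t²)`. -/
theorem exists_norm_integral_mul_halfPlaneKernel_le {φ : ℝ → ℂ} (hφ : Continuous φ)
    (hφs : HasCompactSupport φ) :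
    ∃ D : ℝ, ∀ y : ℝ, 0 < y → y ≤ 1 → ∀ t : ℝ,
      ‖1 / (Real.pi : ℂ) * ∫ x, φ x * (halfPlaneKernel x y t : ℂ)‖ ≤ D * (1 / (1 + t ^ 2)) := by
  obtain ⟨M, hM⟩ := hφ.bounded_above_of_compact_support hφs
  have hM0 : 0 ≤ M := (norm_nonneg _).trans (hM 0)
  obtain ⟨R, hR1, hR⟩ : ∃ R : ℝ, 1 ≤ R ∧ ∀ x, R < |x| → φ x = 0 := by
    obtain ⟨R, hR⟩ := hφs.isCompact.isBounded.subset_closedBall 0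
    refine ⟨max R 1, le_max_right _ _, fun x hx => image_eq_zero_of_notMem_tsupport fun hx' => ?_⟩
    have := hR hx'
    rw [Metric.mem_closedBall, dist_zero_right, Real.norm_eq_abs] at this
    exact absurd ((le_max_left _ _).trans_lt hx) (not_lt.2 this)
  have hint : Integrable fun x => ‖φ x‖ := (hφ.integrable_of_hasCompactSupport hφs).norm
  set N : ℝ := ∫ x, ‖φ x‖ with hN
  have hN0 : 0 ≤ N := integral_nonneg fun _ => norm_nonneg _
  have hpi : ‖1 / (Real.pi : ℂ)‖ = 1 / Real.pi := by
    rw [norm_div, norm_one, Complex.norm_real, Real.norm_of_nonneg Real.pi_pos.le]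
  refine ⟨M * (1 + 4 * R ^ 2) + 8 * N, fun y hy hy1 t => ?_⟩
  rw [norm_mul, hpi]
  -- For `|t| ≤ 2R` the bound `M` of `φ` suffices; for larger `t` the kernel is small on the support
  -- of `φ`, because `|x - t| ≥ |t| / 2` there.
  rcases le_or_gt |t| (2 * R) with ht | ht
  · have h1 : ‖∫ x, φ x * (halfPlaneKernel x y t : ℂ)‖ ≤ M * Real.pi := by
      rw [integral_mul_halfPlaneKernel φ hy, ← integral_univ_inv_one_add_sq, ← integral_const_mul]
      refine norm_integral_le_of_norm_le (integrable_inv_one_add_sq.const_mul M)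
        (Eventually.of_forall fun u => ?_)
      rw [norm_mul, Complex.norm_real, Real.norm_of_nonneg (by positivity)]
      gcongr
      exact hM _
    have ht2 : t ^ 2 ≤ 4 * R ^ 2 := by
      have := sq_le_sq' (abs_le.1 ht).1 (abs_le.1 ht).2
      nlinarith
    calc 1 / Real.pi * ‖∫ x, φ x * (halfPlaneKernel x y t : ℂ)‖
        ≤ 1 / Real.pi * (M * Real.pi) := by gcongr
      _ = M := by field_simp
      _ ≤ (M * (1 + 4 * R ^ 2) + 8 * N) * (1 / (1 + t ^ 2)) := by
        rw [mul_one_div, le_div_iff₀ (by positivity)]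
        nlinarith
  · have h1 : ‖∫ x, φ x * (halfPlaneKernel x y t : ℂ)‖ ≤ N * (8 / (1 + t ^ 2)) := by
      rw [hN, ← integral_mul_const]
      refine norm_integral_le_of_norm_le (hint.mul_const _) (Eventually.of_forall fun x => ?_)
      rw [norm_mul, Complex.norm_real, Real.norm_of_nonneg (halfPlaneKernel_nonneg x hy t)]
      rcases le_or_gt |x| R with hx | hx
      · gcongr
        unfold halfPlaneKernel
        have ht0 : 1 ≤ t ^ 2 := by
          rw [← sq_abs]; nlinarith
        have h2 : |t| / 2 ≤ |x - t| := by
          have := abs_sub_abs_le_abs_sub t x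
          rw [abs_sub_comm] at this
          linarith
        have h3 : t ^ 2 / 4 ≤ (x - t) ^ 2 := by
          rw [← sq_abs t, ← sq_abs (x - t)]
          nlinarith [abs_nonneg t]
        rw [div_le_div_iff₀ (by positivity) (by positivity)]
        nlinarith [sq_nonneg y]
      · rw [hR x hx]; simp
    calc 1 / Real.pi * ‖∫ x, φ x * (halfPlaneKernel x y t : ℂ)‖
        ≤ 1 * (N * (8 / (1 + t ^ 2))) := by
          gcongr
          rw [div_le_one Real.pi_pos]
          linarith [Real.pi_gt_three]
      _ ≤ (M * (1 + 4 * R ^ 2) + 8 * N) * (1 / (1 + t ^ 2)) := by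
        rw [one_mul, mul_div_assoc', mul_one_div]
        gcongr
        nlinarith [mul_nonneg hM0 (show 0 ≤ 1 + 4 * R ^ 2 by positivity)]

theorem isLocallyFiniteMeasure_of_lintegral_lt_top {ρ : Measure ℝ} {w : ℝ → ℝ} (hw : Continuous w)
    (hw0 : ∀ t, 0 < w t) (h : ∫⁻ t, ENNReal.ofReal (w t) ∂ρ < ∞) : IsLocallyFiniteMeasure ρ := by
  refine ⟨fun x => ⟨{t | w x / 2 < w t}, (isOpen_lt continuous_const hw).mem_nhds ?_, ?_⟩⟩
  · simpa using hw0 x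
  · have hpos : ENNReal.ofReal (w x / 2) ≠ 0 := by simpa using hw0 x
    have h1 := mul_meas_ge_le_lintegral (μ := ρ) (f := fun t => ENNReal.ofReal (w t))
      hw.measurable.ennreal_ofReal (ENNReal.ofReal (w x / 2))
    have h2 : ρ {t | ENNReal.ofReal (w x / 2) ≤ ENNReal.ofReal (w t)} < ∞ := by
      refine lt_top_iff_ne_top.2 fun htop => ?_
      rw [htop, ENNReal.mul_top hpos] at h1
      exact absurd h (not_lt.2 h1)
    refine (measure_mono fun t ht => ?_).trans_lt h2
    exact ENNReal.ofReal_le_ofReal (le_of_lt ht)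

theorem continuous_one_div_one_add_sq : Continuous fun t : ℝ => 1 / (1 + t ^ 2) :=
  continuous_const.div (by fun_prop) fun t => by positivity

theorem integrable_one_div_one_add_sq {ρ : Measure ℝ}
    (h : ∫⁻ t : ℝ, ENNReal.ofReal (1 / (1 + t ^ 2)) ∂ρ < ∞) :
    Integrable (fun t : ℝ => 1 / (1 + t ^ 2)) ρ := by
  refine ⟨continuous_one_div_one_add_sq.aestronglyMeasurable, ?_⟩
  rw [hasFiniteIntegral_iff_ofReal (Eventually.of_forall fun t => by positivity)]
  exact h

theorem integrable_halfPlaneKernel {ρ : Measure ℝ}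
    (h : ∫⁻ t : ℝ, ENNReal.ofReal (1 / (1 + t ^ 2)) ∂ρ < ∞) (x : ℝ) {y : ℝ} (hy : 0 < y) :
    Integrable (fun t => (halfPlaneKernel x y t : ℂ)) ρ := by
  refine ((integrable_one_div_one_add_sq h).const_mul
    (y * (2 + (1 + 2 * |x| ^ 2) / y ^ 2))).mono'
    (Complex.continuous_ofReal.comp ((continuous_halfPlaneKernel hy).comp
      (Continuous.prodMk_right x))).aestronglyMeasurable (Eventually.of_forall fun t => ?_)
  rw [Complex.norm_real, Real.norm_of_nonneg (halfPlaneKernel_nonneg x hy t)]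
  exact halfPlaneKernel_le hy le_rfl t

namespace IsPoissonIntegralOf

variable {F : ℂ → ℂ} {μ : BorelComplexMeasure}

theorem isLocallyFiniteMeasure_variation (h : IsPoissonIntegralOf F μ) :
    IsLocallyFiniteMeasure μ.variation :=
  isLocallyFiniteMeasure_of_lintegral_lt_top continuous_one_div_one_add_sq
    (fun t => by positivity) h.lintegral_lt_top

/-- The boundary values, in the weak sense, of the Poisson integral of `μ` are `μ`: by Fubini the
pairing with `φ` moves the Poisson kernel to `φ`. -/
theorem tendsto_integral_mul (hF : IsPoissonIntegralOf F μ) {φ : ℝ → ℂ} (hφ : Continuous φ)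
    (hφs : HasCompactSupport φ) :
    Tendsto (fun y : ℝ => ∫ x : ℝ, φ x * F (x + y * Complex.I)) (𝓝[>] 0) (𝓝 (μ.integral φ)) := by
  have := hF.isLocallyFiniteMeasure_variation
  obtain ⟨h, H⟩ := BorelComplexMeasure.exists_hasDensity (le_refl μ.variation)
  have hweight := integrable_one_div_one_add_sq hF.lintegral_lt_top
  obtain ⟨C, hC⟩ := H.bounded
  set ρ := μ.variation
  obtain ⟨R, hR⟩ : ∃ R : ℝ, ∀ x, R < |x| → φ x = 0 := by
    obtain ⟨R, hR⟩ := hφs.isCompact.isBounded.subset_closedBall 0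
    refine ⟨R, fun x hx => image_eq_zero_of_notMem_tsupport fun hx' => ?_⟩
    have := hR hx'
    rw [Metric.mem_closedBall, dist_zero_right, Real.norm_eq_abs] at this
    exact absurd hx (not_lt.2 this)
  have key : ∀ y : ℝ, 0 < y → ∫ x : ℝ, φ x * F (x + y * Complex.I) =
      ∫ t, (1 / (Real.pi : ℂ) * ∫ x, φ x * (halfPlaneKernel x y t : ℂ)) * h t ∂ρ := fun y hy => by
    have hprod : Integrable (Function.uncurry fun x t : ℝ =>
        φ x * (halfPlaneKernel x y t : ℂ) * h t) (volume.prod ρ) := by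
      have hK : Integrable (fun p : ℝ × ℝ => φ p.1 * (halfPlaneKernel p.1 y p.2 : ℂ))
          (volume.prod ρ) := by
        have hφi := (hφ.integrable_of_hasCompactSupport (μ := volume) hφs).norm
        refine (hφi.mul_prod (hweight.const_mul (y * (2 + (1 + 2 * R ^ 2) / y ^ 2)))).mono'
          ?_ (Eventually.of_forall fun p => ?_)
        · exact ((hφ.comp continuous_fst).mul
            (Complex.continuous_ofReal.comp (continuous_halfPlaneKernel hy))).aestronglyMeasurable
        · rw [norm_mul, Complex.norm_real, Real.norm_of_nonneg (halfPlaneKernel_nonneg _ hy _)]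
          rcases le_or_gt |p.1| R with hx | hx
          · gcongr
            exact halfPlaneKernel_le hy hx _
          · simp [hR _ hx]
      exact hK.mul_bdd (c := C) H.aestronglyMeasurable.comp_snd
        (Measure.quasiMeasurePreserving_snd.ae hC)
    calc ∫ x : ℝ, φ x * F (x + y * Complex.I)
        = ∫ x : ℝ, ∫ t, 1 / (Real.pi : ℂ) * (φ x * (halfPlaneKernel x y t : ℂ) * h t) ∂ρ := by
          refine integral_congr_ae (Eventually.of_forall fun x => ?_)
          simp only
          rw [hF.eq_integral x y hy, integral_const_mul]
          change φ x * (1 / (Real.pi : ℂ) * μ.integral fun t => (halfPlaneKernel x y t : ℂ)) = _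
          rw [H.integral_eq (integrable_halfPlaneKernel hF.lintegral_lt_top x hy)]
          simp only [mul_assoc, integral_const_mul]
          rw [mul_left_comm]
      _ = ∫ t, (∫ x : ℝ, 1 / (Real.pi : ℂ) * (φ x * (halfPlaneKernel x y t : ℂ) * h t)) ∂ρ :=
          integral_integral_swap (hprod.const_mul _)
      _ = _ := by
          refine integral_congr_ae (Eventually.of_forall fun t => ?_)
          simp only [integral_const_mul, integral_mul_const]
          rw [mul_assoc]
  obtain ⟨M, hM⟩ := hφ.bounded_above_of_compact_support hφs
  obtain ⟨D, hD⟩ := exists_norm_integral_mul_halfPlaneKernel_le hφ hφs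
  rw [H.integral_eq (hφ.integrable_of_hasCompactSupport hφs)]
  have hsmall : ∀ᶠ y : ℝ in 𝓝[>] 0, 0 < y ∧ y ≤ 1 :=
    (eventually_mem_nhdsWithin).and (nhdsWithin_le_nhds (Iic_mem_nhds zero_lt_one))
  refine Tendsto.congr' (hsmall.mono fun y hy => (key y hy.1).symm) ?_
  have hmeas : ∀ y : ℝ, 0 < y → AEStronglyMeasurable
      (fun t => 1 / (Real.pi : ℂ) * ∫ x, φ x * (halfPlaneKernel x y t : ℂ)) ρ := fun y hy => by
    refine AEStronglyMeasurable.const_mul ?_ _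
    have hc : Continuous fun p : ℝ × ℝ => φ p.2 * (halfPlaneKernel p.2 y p.1 : ℂ) :=
      (hφ.comp continuous_snd).mul (Complex.continuous_ofReal.comp
        ((continuous_halfPlaneKernel hy).comp continuous_swap))
    exact (hc.stronglyMeasurable.integral_prod_right (ν := volume)).aestronglyMeasurable
  refine tendsto_integral_filter_of_dominated_convergence
    (fun t => D * (1 / (1 + t ^ 2)) * C) (hsmall.mono fun y hy => ?_)
    (hsmall.mono fun y hy => ?_) ((hweight.const_mul D).mul_const C) ?_
  · exact (hmeas y hy.1).mul H.aestronglyMeasurable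
  · filter_upwards [hC] with t ht
    rw [norm_mul]
    exact mul_le_mul (hD y hy.1 hy.2 t) ht (norm_nonneg _)
      ((norm_nonneg _).trans (hD y hy.1 hy.2 t))
  · exact Eventually.of_forall fun t =>
      (tendsto_integral_mul_halfPlaneKernel hφ hM t).mul_const _

/-- A function is the Poisson integral of at most one complex measure. -/
theorem unique {ν : BorelComplexMeasure} (hμ : IsPoissonIntegralOf F μ)
    (hν : IsPoissonIntegralOf F ν) : μ = ν := by
  have := hμ.isLocallyFiniteMeasure_variation
  have := hν.isLocallyFiniteMeasure_variation
  exact BorelComplexMeasure.eq_of_forall_integral_eq fun φ hφ hφs =>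
    tendsto_nhds_unique (hμ.tendsto_integral_mul hφ hφs) (hν.tendsto_integral_mul hφ hφs)

end IsPoissonIntegralOf

/-! ### The Poisson formula for the half-plane -/

/-- The circle of radius `R` touching the real line from above at the origin, parametrized by the
signed arc length from the origin. -/
noncomputable def tangentCircle (R s : ℝ) : ℂ := ⟨R * Real.sin (s / R), R * (1 - Real.cos (s / R))⟩

theorem continuous_tangentCircle (R : ℝ) : Continuous (tangentCircle R) := by
  have : tangentCircle R = fun s => ((R * Real.sin (s / R) : ℝ) : ℂ) +
      ((R * (1 - Real.cos (s / R)) : ℝ) : ℂ) * Complex.I := by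
    funext s
    exact Complex.mk_eq_add_mul_I _ _
  rw [this]
  fun_prop

theorem tangentCircle_im_nonneg {R : ℝ} (hR : 0 < R) (s : ℝ) : 0 ≤ (tangentCircle R s).im :=
  mul_nonneg hR.le (by linarith [Real.cos_le_one (s / R)])

theorem circleMap_eq_tangentCircle (R θ : ℝ) (hR : 0 < R) :
    circleMap (R * Complex.I) R (θ - Real.pi / 2) = tangentCircle R (R * θ) := by
  have e : R * θ / R = θ := by field_simp
  apply Complex.ext
  · simp [circleMap, tangentCircle, e, Complex.exp_re, Real.cos_sub_pi_div_two]
  · simp [circleMap, tangentCircle, e, Complex.exp_im, Real.sin_sub_pi_div_two]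
    ring

theorem tendsto_tangentCircle (s : ℝ) :
    Tendsto (fun R => tangentCircle R s) atTop (𝓝 (s : ℂ)) := by
  have hinv : Tendsto (fun R : ℝ => s / R) atTop (𝓝 0) := tendsto_const_nhds.div_atTop tendsto_id
  have hsin : Tendsto (fun R : ℝ => R * Real.sin (s / R)) atTop (𝓝 s) := by
    have h1 : Tendsto (fun R : ℝ => s * Real.sinc (s / R)) atTop (𝓝 (s * Real.sinc 0)) :=
      (Real.continuous_sinc.tendsto 0 |>.comp hinv).const_mul s
    rw [Real.sinc_zero, mul_one] at h1
    refine h1.congr' ((eventually_gt_atTop 0).mono fun R hR => ?_)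
    rcases eq_or_ne s 0 with rfl | hs
    · simp
    · simp only
      rw [Real.sinc_of_ne_zero (by positivity)]
      field_simp
  have hcos : Tendsto (fun R : ℝ => R * (1 - Real.cos (s / R))) atTop (𝓝 0) := by
    have h1 : Tendsto (fun R : ℝ => s ^ 2 / 2 / R) atTop (𝓝 0) :=
      tendsto_const_nhds.div_atTop tendsto_id
    refine tendsto_of_tendsto_of_tendsto_of_le_of_le' tendsto_const_nhds h1
      ((eventually_gt_atTop 0).mono fun R hR => tangentCircle_im_nonneg hR s)
      ((eventually_gt_atTop 0).mono fun R hR => ?_)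
    have := Real.one_sub_sq_div_two_le_cos (x := s / R)
    calc R * (1 - Real.cos (s / R)) ≤ R * ((s / R) ^ 2 / 2) := by gcongr; linarith
      _ = s ^ 2 / 2 / R := by field_simp
  have h := ((Complex.continuous_ofReal.tendsto s).comp hsin).add
    (((Complex.continuous_ofReal.tendsto 0).comp hcos).mul_const Complex.I)
  simp only [Complex.ofReal_zero, zero_mul, add_zero] at h
  refine h.congr fun R => ?_
  simp only [Function.comp, tangentCircle]
  exact (Complex.mk_eq_add_mul_I _ _).symm

/-- A chord from the origin is at least `2 / π` times as long as the arc. -/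
theorem le_norm_tangentCircle {R s : ℝ} (hR : 0 < R) (hs : |s| ≤ Real.pi * R) :
    2 / Real.pi * |s| ≤ ‖tangentCircle R s‖ := by
  have hu : |s / R| ≤ Real.pi := by
    rwa [abs_div, abs_of_pos hR, div_le_iff₀ hR]
  have h1 := Real.cos_le_one_sub_mul_cos_sq hu
  refine le_of_sq_le_sq ?_ (norm_nonneg _)
  rw [← Complex.normSq_eq_norm_sq, Complex.normSq_apply, mul_pow, sq_abs]
  have h2 := Real.sin_sq_add_cos_sq (s / R)
  calc (2 / Real.pi) ^ 2 * s ^ 2 = 2 * R ^ 2 * (2 / Real.pi ^ 2 * (s / R) ^ 2) := by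
        field_simp
    _ ≤ 2 * R ^ 2 * (1 - Real.cos (s / R)) := by gcongr; linarith
    _ = R ^ 2 * (1 + 1 - 2 * Real.cos (s / R)) := by ring
    _ = R ^ 2 * (Real.sin (s / R) ^ 2 + Real.cos (s / R) ^ 2 + 1 - 2 * Real.cos (s / R)) := by
      rw [h2]
    _ = _ := by
      simp only [tangentCircle]
      ring

/-- On the large tangent circles, the squared distance to a point `w` of the upper half-plane
grows at least like `1 + s²`, uniformly in the radius. -/
theorem exists_le_norm_tangentCircle_sub_sq {w : ℂ} (hw : 0 < w.im) :
    ∃ c : ℝ, 0 < c ∧ ∀ᶠ R : ℝ in atTop, ∀ s : ℝ, |s| ≤ Real.pi * R →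
      c * (1 + s ^ 2) ≤ ‖tangentCircle R s - w‖ ^ 2 := by
  -- Points at arc length more than `S` have norm at least `2‖w‖`. The other points are near the real
  -- line for large `R`, at height less than half that of `w`.
  set S : ℝ := Real.pi * ‖w‖ with hS
  have hw0 : 0 < ‖w‖ := norm_pos_iff.2 fun h => by simp [h] at hw
  have hS0 : 0 < S := mul_pos Real.pi_pos hw0
  refine ⟨min ((w.im / 2) ^ 2 / (1 + S ^ 2)) (S ^ 2 / (Real.pi ^ 2 * (1 + S ^ 2))),
    lt_min (by positivity) (by positivity), ?_⟩
  filter_upwards [eventually_gt_atTop 0, eventually_ge_atTop (S ^ 2 / w.im)] with R hR hR2 s hs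
  rcases le_or_gt |s| S with h | h
  · have hs2 : s ^ 2 ≤ S ^ 2 := sq_le_sq' (abs_le.1 h).1 (abs_le.1 h).2
    have him : (tangentCircle R s).im ≤ w.im / 2 := by
      have := Real.one_sub_sq_div_two_le_cos (x := s / R)
      calc R * (1 - Real.cos (s / R)) ≤ R * ((s / R) ^ 2 / 2) := by gcongr; linarith
        _ = s ^ 2 / (2 * R) := by field_simp
        _ ≤ w.im / 2 := by
          rw [div_le_iff₀ (by positivity)]
          rw [div_le_iff₀ hw] at hR2
          linarith
    have h1 : w.im / 2 ≤ ‖tangentCircle R s - w‖ := by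
      have := Complex.abs_im_le_norm (tangentCircle R s - w)
      rw [Complex.sub_im, abs_sub_comm] at this
      linarith [le_abs_self (w.im - (tangentCircle R s).im)]
    calc _ ≤ (w.im / 2) ^ 2 / (1 + S ^ 2) * (1 + S ^ 2) := by
          gcongr
          exact min_le_left _ _
      _ = (w.im / 2) ^ 2 := by field_simp
      _ ≤ _ := by gcongr
  · have hs2 : S ^ 2 ≤ s ^ 2 := by rw [← sq_abs s]; gcongr
    have h1 : |s| / Real.pi ≤ ‖tangentCircle R s - w‖ := by
      have h2 := le_norm_tangentCircle hR hs
      have h3 := norm_sub_norm_le (tangentCircle R s) w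
      have h4 : ‖w‖ ≤ |s| / Real.pi := by
        rw [le_div_iff₀ Real.pi_pos]
        linarith
      have h5 : 2 / Real.pi * |s| = |s| / Real.pi + |s| / Real.pi := by ring
      linarith
    calc _ ≤ S ^ 2 / (Real.pi ^ 2 * (1 + S ^ 2)) * (1 + s ^ 2) := by
          gcongr
          exact min_le_right _ _
      _ ≤ s ^ 2 / Real.pi ^ 2 := by
        rw [div_mul_eq_mul_div, div_le_div_iff₀ (by positivity) (by positivity)]
        nlinarith [sq_nonneg Real.pi, mul_nonneg (sq_nonneg Real.pi) (sub_nonneg.2 hs2)]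
      _ = (|s| / Real.pi) ^ 2 := by rw [div_pow, sq_abs]
      _ ≤ _ := by gcongr

open InnerProductSpace in
/-- The Poisson integral formula for the disc bounded by a tangent circle, with the integral over
the circle written in terms of arc length. -/
theorem eq_integral_tangentCircle {g : ℂ → ℝ} (hg : HarmonicOnNhd g {z | 0 ≤ z.im}) {R : ℝ}
    (hR : 0 < R) {w : ℂ} (hw : w ∈ Metric.ball (R * Complex.I) R) :
    g w = 1 / Real.pi * ∫ s in Ioc (-(Real.pi * R)) (Real.pi * R),
      (w.im - ‖w‖ ^ 2 / (2 * R)) / ‖tangentCircle R s - w‖ ^ 2 * g (tangentCircle R s) := by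
  have hball : Metric.closedBall (R * Complex.I) R ⊆ {z | 0 ≤ z.im} := fun z hz => by
    have h1 := Complex.abs_im_le_norm (z - R * Complex.I)
    rw [Metric.mem_closedBall, dist_eq_norm] at hz
    have h2 := neg_le_of_abs_le (h1.trans hz)
    simp at h2
    exact h2
  have hP := (show HarmonicOnNhd g (Metric.closedBall (R * Complex.I) R) from
    fun z hz => hg z (hball hz)).circleAverage_poissonKernel_smul hw
  set f : ℂ → ℝ := poissonKernel (R * Complex.I) w • g with hf
  have hkernel : ∀ s, f (tangentCircle R s) = 2 * R * ((w.im - ‖w‖ ^ 2 / (2 * R)) /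
      ‖tangentCircle R s - w‖ ^ 2 * g (tangentCircle R s)) := fun s => by
    have h1 : ‖tangentCircle R s - R * Complex.I‖ ^ 2 = R ^ 2 := by
      have := Real.sin_sq_add_cos_sq (s / R)
      rw [← Complex.normSq_eq_norm_sq, Complex.normSq_apply]
      simp [tangentCircle]
      linear_combination R ^ 2 * this
    have h2 : ‖w - R * Complex.I‖ ^ 2 = ‖w‖ ^ 2 - 2 * R * w.im + R ^ 2 := by
      rw [← Complex.normSq_eq_norm_sq, ← Complex.normSq_eq_norm_sq, Complex.normSq_apply,
        Complex.normSq_apply]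
      simp
      ring
    rw [hf, Pi.smul_apply', poissonKernel_def, h1, h2, sub_sub_sub_cancel_right,
      smul_eq_mul]
    field_simp
    ring
  -- The full circle is traversed from its top, which has arc length `-πR` from the origin.
  have hshift : ∫ θ in (0)..2 * Real.pi, f (circleMap (R * Complex.I) R (θ + -(3 * Real.pi / 2))) =
      ∫ θ in (-Real.pi)..Real.pi, f (tangentCircle R (R * θ)) := by
    have := intervalIntegral.integral_comp_sub_right (a := 0) (b := 2 * Real.pi)
      (fun θ => f (tangentCircle R (R * θ))) Real.pi
    rw [show 2 * Real.pi - Real.pi = Real.pi by ring, zero_sub] at this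
    rw [← this]
    refine intervalIntegral.integral_congr fun θ _ => ?_
    rw [← circleMap_eq_tangentCircle R _ hR]
    ring_nf
  have hscale := intervalIntegral.integral_comp_mul_left (a := -Real.pi) (b := Real.pi)
    (fun s => f (tangentCircle R s)) hR.ne'
  rw [Real.circleAverage_eq_integral_add (-(3 * Real.pi / 2)), hshift, hscale] at hP
  rw [← hP, intervalIntegral.integral_of_le (by nlinarith [Real.pi_pos]),
    show R * -Real.pi = -(Real.pi * R) by ring, mul_comm R Real.pi]
  simp only [hkernel]
  rw [integral_const_mul, smul_eq_mul, smul_eq_mul]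
  field_simp

open InnerProductSpace in
/-- The Poisson integral formula for a bounded real harmonic function on the closed upper
half-plane, obtained from the formula on the discs bounded by tangent circles as their radius tends
to infinity. -/
theorem eq_integral_halfPlaneKernel_mul {g : ℂ → ℝ} (hg : HarmonicOnNhd g {z | 0 ≤ z.im}) {K : ℝ}
    (hK : ∀ z : ℂ, 0 ≤ z.im → |g z| ≤ K) (x : ℝ) {y : ℝ} (hy : 0 < y) :
    g (x + y * Complex.I) = 1 / Real.pi * ∫ t : ℝ, halfPlaneKernel x y t * g t := by
  set w : ℂ := x + y * Complex.I with hw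
  have hwim : w.im = y := by simp [hw]
  obtain ⟨c, hc, hcR⟩ := exists_le_norm_tangentCircle_sub_sq (w := w) (by rwa [hwim])
  have hK0 : 0 ≤ K := (abs_nonneg _).trans (hK 0 (by simp))
  have hgc : ContinuousOn g {z | 0 ≤ z.im} := hg.continuousOn
  have hsmall : Tendsto (fun R : ℝ => w.im - ‖w‖ ^ 2 / (2 * R)) atTop (𝓝 y) := by
    have h1 : Tendsto (fun R : ℝ => ‖w‖ ^ 2 / (2 * R)) atTop (𝓝 0) :=
      tendsto_const_nhds.div_atTop (tendsto_id.const_mul_atTop two_pos)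
    simpa [hwim] using (tendsto_const_nhds (x := w.im)).sub h1
  -- Dominated convergence, with the majorant `K y / (c (1 + s²))`.
  have hlim : Tendsto (fun R : ℝ => ∫ s, (Ioc (-(Real.pi * R)) (Real.pi * R)).indicator (fun s =>
      (w.im - ‖w‖ ^ 2 / (2 * R)) / ‖tangentCircle R s - w‖ ^ 2 * g (tangentCircle R s)) s) atTop
      (𝓝 (∫ t : ℝ, halfPlaneKernel x y t * g t)) := by
    refine tendsto_integral_filter_of_dominated_convergence
      (fun s => (y / c * (1 + s ^ 2)⁻¹) * K) ?_ ?_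
      ((integrable_inv_one_add_sq.const_mul _).mul_const _) (Eventually.of_forall fun s => ?_)
    · filter_upwards [eventually_gt_atTop 0] with R hR
      refine (AEStronglyMeasurable.mul ?_ ?_).indicator measurableSet_Ioc
      · have := (continuous_tangentCircle R).measurable
        exact Measurable.aestronglyMeasurable (by fun_prop)
      · exact (hgc.comp_continuous (continuous_tangentCircle R)
          (tangentCircle_im_nonneg hR)).aestronglyMeasurable
    · filter_upwards [eventually_gt_atTop 0, hcR, hsmall.eventually (lt_mem_nhds hy)] with R hR hcR hR2
      refine Eventually.of_forall fun s => ?_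
      rw [Set.indicator_apply]
      split_ifs with hs
      · have h1 := hcR s (abs_le.2 ⟨hs.1.le, hs.2⟩)
        have h2 : w.im - ‖w‖ ^ 2 / (2 * R) ≤ y := by
          rw [hwim, sub_le_self_iff]
          positivity
        rw [norm_mul, Real.norm_of_nonneg (by positivity), ← div_eq_mul_inv, div_div]
        gcongr
        exact hK _ (tangentCircle_im_nonneg hR s)
      · rw [norm_zero]
        positivity
    · have hz := tendsto_tangentCircle s
      have hgz : Tendsto (fun R => g (tangentCircle R s)) atTop (𝓝 (g s)) :=
        (hg s (by simp)).1.continuousAt.tendsto.comp hz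
      have hnorm : ‖(s : ℂ) - w‖ ^ 2 = (x - s) ^ 2 + y ^ 2 := by
        rw [← Complex.normSq_eq_norm_sq, Complex.normSq_apply]
        simp [hw]
        ring
      have hk : Tendsto (fun R => (w.im - ‖w‖ ^ 2 / (2 * R)) / ‖tangentCircle R s - w‖ ^ 2) atTop
          (𝓝 (halfPlaneKernel x y s)) := by
        unfold halfPlaneKernel
        rw [← hnorm]
        exact hsmall.div ((hz.sub_const w).norm.pow 2) (by rw [hnorm]; positivity)
      refine (hk.mul hgz).congr' ?_
      filter_upwards [eventually_gt_atTop |s|] with R hR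
      have : |s| < Real.pi * R := by nlinarith [Real.pi_gt_three, abs_nonneg s]
      rw [Set.indicator_of_mem (show s ∈ Ioc _ _ from ⟨(abs_lt.1 this).1, (abs_lt.1 this).2.le⟩)]
  refine tendsto_nhds_unique ?_ (hlim.const_mul (1 / Real.pi))
  refine tendsto_const_nhds.congr' ?_
  filter_upwards [eventually_gt_atTop 0, eventually_gt_atTop (‖w‖ ^ 2 / y)] with R hR hR2
  -- The point `w` lies in the disc of radius `R` as soon as `‖w‖² < 2 R y`.
  rw [integral_indicator measurableSet_Ioc]
  refine eq_integral_tangentCircle hg hR ?_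
  rw [Metric.mem_ball, dist_eq_norm]
  refine lt_of_pow_lt_pow_left₀ 2 hR.le ?_
  have h2 : ‖w - R * Complex.I‖ ^ 2 = ‖w‖ ^ 2 - 2 * R * w.im + R ^ 2 := by
    rw [← Complex.normSq_eq_norm_sq, ← Complex.normSq_eq_norm_sq, Complex.normSq_apply,
      Complex.normSq_apply]
    simp
    ring
  rw [h2, hwim]
  rw [div_lt_iff₀ hy] at hR2
  nlinarith

/-! ### Weak compactness of weighted densities -/

open scoped CompactlySupported

/-- A continuous cutoff function: one on `[-n, n]` and zero off `[-n - 1, n + 1]`. -/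
noncomputable def cutoff (n : ℕ) (t : ℝ) : ℝ := max 0 (min 1 (n + 1 - |t|))

theorem continuous_cutoff (n : ℕ) : Continuous (cutoff n) := by
  unfold cutoff; fun_prop

theorem cutoff_nonneg (n : ℕ) (t : ℝ) : 0 ≤ cutoff n t := le_max_left _ _

theorem cutoff_le_one (n : ℕ) (t : ℝ) : cutoff n t ≤ 1 := max_le zero_le_one (min_le_left _ _)

theorem cutoff_eq_one {n : ℕ} {t : ℝ} (h : |t| ≤ n) : cutoff n t = 1 := by
  unfold cutoff
  rw [min_eq_left (by linarith), max_eq_right zero_le_one]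

theorem cutoff_mono (t : ℝ) : Monotone fun n => cutoff n t := fun m n h => by
  have : (m : ℝ) ≤ n := by exact_mod_cast h
  exact max_le_max le_rfl (min_le_min le_rfl (by linarith))

theorem hasCompactSupport_cutoff (n : ℕ) : HasCompactSupport (cutoff n) :=
  HasCompactSupport.intro (isCompact_Icc (a := -((n : ℝ) + 1)) (b := n + 1)) fun t ht => by
    have : (n : ℝ) + 1 < |t| := by
      by_contra! h
      exact ht (abs_le.1 h)
    unfold cutoff
    rw [max_eq_left]
    exact (min_le_right _ _).trans (by linarith)

section WeakLimit

variable {ι : Type*} (U : Ultrafilter ι) {k : ι → ℝ → ℝ} {w : ℝ → ℝ} {M : ℝ}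

theorem exists_abs_le_mul_of_hasCompactSupport (hw : Continuous w) (hw0 : ∀ t, 0 < w t)
    {φ : ℝ → ℝ} (hφ : Continuous φ) (hφs : HasCompactSupport φ) :
    ∃ D : ℝ, 0 ≤ D ∧ ∀ t, |φ t| ≤ D * w t := by
  have hc : Continuous fun t => φ t * (w t)⁻¹ := hφ.mul (hw.inv₀ fun t => (hw0 t).ne')
  obtain ⟨D, hD⟩ := hc.bounded_above_of_compact_support hφs.mul_right
  refine ⟨D, (norm_nonneg _).trans (hD 0), fun t => ?_⟩
  have := hD t
  rwa [Real.norm_eq_abs, abs_mul, abs_inv, abs_of_pos (hw0 t), ← div_eq_mul_inv,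
    div_le_iff₀ (hw0 t)] at this

theorem integrable_mul_of_abs_le {k w φ : ℝ → ℝ} {ρ : Measure ℝ}
    (hk : AEStronglyMeasurable k ρ) (hk0 : ∀ t, 0 ≤ k t) (hwk : Integrable (fun t => w t * k t) ρ)
    (hφ : Continuous φ) {D : ℝ} (hD : ∀ t, |φ t| ≤ D * w t) :
    Integrable (fun t => φ t * k t) ρ := by
  refine (hwk.const_mul D).mono' (hφ.aestronglyMeasurable.mul hk) (Eventually.of_forall fun t => ?_)
  rw [Real.norm_eq_abs, abs_mul, abs_of_nonneg (hk0 t), ← mul_assoc]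
  exact mul_le_mul_of_nonneg_right (hD t) (hk0 t)

theorem abs_integral_mul_le {k w φ : ℝ → ℝ} {ρ : Measure ℝ}
    (hk0 : ∀ t, 0 ≤ k t) (hwk : Integrable (fun t => w t * k t) ρ)
    {D : ℝ} (hD : ∀ t, |φ t| ≤ D * w t) :
    |∫ t, φ t * k t ∂ρ| ≤ D * ∫ t, w t * k t ∂ρ := by
  rw [← integral_const_mul, ← Real.norm_eq_abs]
  refine norm_integral_le_of_norm_le (hwk.const_mul D) (Eventually.of_forall fun t => ?_)
  rw [Real.norm_eq_abs, abs_mul, abs_of_nonneg (hk0 t), ← mul_assoc]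
  exact mul_le_mul_of_nonneg_right (hD t) (hk0 t)

/-- Weak compactness: nonnegative densities `k i` whose integrals against a positive continuous
weight `w` are bounded converge along any ultrafilter to a measure `ν`, in the sense that the
integrals of continuous functions of smaller order than `w` converge. The measure comes from the
Riesz–Markov–Kakutani theorem; no mass is lost at infinity because the tails of the integrals are
uniformly small. -/
theorem exists_measure_tendsto_integral_mul (hw : Continuous w) (hw0 : ∀ t, 0 < w t)
    (hk : ∀ i, AEStronglyMeasurable (k i)) (hk0 : ∀ i t, 0 ≤ k i t)
    (hwk : ∀ i, Integrable fun t => w t * k i t) (hM : ∀ i, ∫ t, w t * k i t ≤ M) :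
    ∃ ν : Measure ℝ, IsLocallyFiniteMeasure ν ∧ Integrable w ν ∧
      ∀ p : ℝ → ℝ, Continuous p → (∀ ε > 0, ∃ n : ℕ, ∀ t : ℝ, (n : ℝ) ≤ |t| → |p t| ≤ ε * w t) →
        (∀ i, Integrable fun t => p t * k i t) ∧ Integrable p ν ∧
          Tendsto (fun i => ∫ t, p t * k i t) U (𝓝 (∫ t, p t ∂ν)) := by
  have hlim : ∀ φ : C_c(ℝ, ℝ), ∃ L : ℝ, Tendsto (fun i => ∫ t, φ t * k i t) U (𝓝 L) := fun φ => by
    obtain ⟨D, hD0, hD⟩ := exists_abs_le_mul_of_hasCompactSupport hw hw0 φ.continuous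
      φ.hasCompactSupport
    obtain ⟨L, -, hL⟩ := (isCompact_Icc (a := -(D * M)) (b := D * M)).ultrafilter_le_nhds
      (U.map fun i => ∫ t, φ t * k i t) (by
        rw [le_principal_iff, Ultrafilter.coe_map, mem_map]
        refine Filter.univ_mem' fun i => abs_le.1 ?_
        exact (abs_integral_mul_le (hk0 i) (hwk i) hD).trans
          (mul_le_mul_of_nonneg_left (hM i) hD0))
    exact ⟨L, hL⟩
  have hint : ∀ (φ : C_c(ℝ, ℝ)) i, Integrable fun t => φ t * k i t := fun φ i => by
    obtain ⟨D, hD0, hD⟩ := exists_abs_le_mul_of_hasCompactSupport hw hw0 φ.continuous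
      φ.hasCompactSupport
    exact integrable_mul_of_abs_le (hk i) (hk0 i) (hwk i) φ.continuous hD
  choose L hL using hlim
  let Λ : C_c(ℝ, ℝ) →ₚ[ℝ] ℝ := PositiveLinearMap.mk₀
    { toFun := L
      map_add' := fun φ ψ => by
        refine tendsto_nhds_unique (hL (φ + ψ)) (((hL φ).add (hL ψ)).congr fun i => ?_)
        rw [← integral_add (hint φ i) (hint ψ i)]
        simp [add_mul]
      map_smul' := fun c φ => by
        refine tendsto_nhds_unique (hL (c • φ)) (((hL φ).const_mul c).congr fun i => ?_)
        rw [← integral_const_mul]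
        simp [mul_assoc] }
    fun φ hφ => ge_of_tendsto' (hL φ) fun i =>
      integral_nonneg fun t => mul_nonneg (hφ t) (hk0 i t)
  set ν := RealRMK.rieszMeasure Λ with hν
  have hνL : ∀ φ : C_c(ℝ, ℝ), ∫ t, φ t ∂ν = L φ := RealRMK.integral_rieszMeasure Λ
  have hcc : ∀ φ : ℝ → ℝ, Continuous φ → HasCompactSupport φ →
      Tendsto (fun i => ∫ t, φ t * k i t) U (𝓝 (∫ t, φ t ∂ν)) := fun φ hφ hφs => by
    have := hL ⟨⟨φ, hφ⟩, hφs⟩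
    rwa [← hνL] at this
  have hfin : IsLocallyFiniteMeasure ν := inferInstance
  -- The limit measure integrates `w`, by monotone convergence over the cutoffs.
  have hwν : Integrable w ν := by
    have h1 : ∀ n : ℕ, ∫⁻ t, ENNReal.ofReal (cutoff n t * w t) ∂ν ≤ ENNReal.ofReal M := fun n => by
      have hc : Continuous fun t => cutoff n t * w t := (continuous_cutoff n).mul hw
      have hcs : HasCompactSupport fun t => cutoff n t * w t :=
        (hasCompactSupport_cutoff n).mul_right
      rw [← ofReal_integral_eq_lintegral_ofReal (hc.integrable_of_hasCompactSupport hcs)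
        (Eventually.of_forall fun t => mul_nonneg (cutoff_nonneg n t) (hw0 t).le)]
      refine ENNReal.ofReal_le_ofReal (le_of_tendsto' (hcc _ hc hcs) fun i => ?_)
      refine (le_abs_self _).trans ((abs_integral_mul_le (D := 1) (hk0 i) (hwk i) fun t => ?_).trans
        ((one_mul _).trans_le (hM i)))
      rw [abs_of_nonneg (mul_nonneg (cutoff_nonneg n t) (hw0 t).le)]
      exact mul_le_mul_of_nonneg_right (cutoff_le_one n t) (hw0 t).le
    have h2 : Tendsto (fun n : ℕ => ∫⁻ t, ENNReal.ofReal (cutoff n t * w t) ∂ν) atTop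
        (𝓝 (∫⁻ t, ENNReal.ofReal (w t) ∂ν)) := by
      refine lintegral_tendsto_of_tendsto_of_monotone
        (fun n => ((continuous_cutoff n).mul hw).measurable.ennreal_ofReal.aemeasurable)
        (Eventually.of_forall fun t m n h => ENNReal.ofReal_le_ofReal
          (mul_le_mul_of_nonneg_right (cutoff_mono t h) (hw0 t).le))
        (Eventually.of_forall fun t => ?_)
      refine tendsto_const_nhds.congr' ?_
      obtain ⟨n, hn⟩ := exists_nat_ge |t|
      filter_upwards [eventually_ge_atTop n] with m hm
      rw [cutoff_eq_one (hn.trans (by exact_mod_cast hm)), one_mul]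
    refine ⟨hw.aestronglyMeasurable, ?_⟩
    rw [hasFiniteIntegral_iff_ofReal (Eventually.of_forall fun t => (hw0 t).le)]
    exact (le_of_tendsto' h2 h1).trans_lt ENNReal.ofReal_lt_top
  refine ⟨ν, hfin, hwν, fun p hp hpw => ?_⟩
  have hc : ∀ n, Continuous fun t => cutoff n t * p t := fun n => (continuous_cutoff n).mul hp
  have hcs : ∀ n, HasCompactSupport fun t => cutoff n t * p t := fun n =>
    (hasCompactSupport_cutoff n).mul_right
  -- Cutting `p` off far out changes the integrals against all `k i` and `ν` by little.
  have htail : ∀ ε > 0, ∃ n : ℕ, ∀ t, |p t - cutoff n t * p t| ≤ ε * w t := fun ε hε => by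
    obtain ⟨n, hn⟩ := hpw ε hε
    refine ⟨n, fun t => ?_⟩
    rcases le_total |t| n with h | h
    · rw [cutoff_eq_one h, one_mul, sub_self, abs_zero]
      exact mul_nonneg hε.le (hw0 t).le
    · rw [← one_sub_mul, abs_mul, abs_of_nonneg (sub_nonneg.2 (cutoff_le_one n t))]
      exact (mul_le_of_le_one_left (abs_nonneg _) (by linarith [cutoff_nonneg n t])).trans (hn t h)
  obtain ⟨D, hD⟩ : ∃ D, ∀ t, |p t| ≤ D * w t := by
    obtain ⟨n, hn⟩ := htail 1 one_pos
    obtain ⟨D, -, hD⟩ := exists_abs_le_mul_of_hasCompactSupport hw hw0 (hc n) (hcs n)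
    refine ⟨1 + D, fun t => ?_⟩
    have := abs_add_le (p t - cutoff n t * p t) (cutoff n t * p t)
    rw [sub_add_cancel] at this
    linarith [hn t, hD t]
  have hpk : ∀ i, Integrable fun t => p t * k i t := fun i =>
    integrable_mul_of_abs_le (hk i) (hk0 i) (hwk i) hp hD
  have hpν : Integrable p ν :=
    (hwν.const_mul D).mono' hp.aestronglyMeasurable (Eventually.of_forall hD)
  refine ⟨hpk, hpν, Metric.tendsto_nhds.2 fun δ hδ => ?_⟩
  set W := ∫ t, w t ∂ν with hW
  have hW0 : 0 ≤ W := integral_nonneg fun t => (hw0 t).le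
  set N := |M| + W + 1 with hN
  have hN0 : 0 < N := by positivity
  obtain ⟨n, hn⟩ := htail (δ / (2 * N)) (by positivity)
  filter_upwards [Metric.tendsto_nhds.1 (hcc _ (hc n) (hcs n)) (δ / (2 * N)) (by positivity)]
    with i hi
  rw [Real.dist_eq] at hi ⊢
  have hck : Integrable fun t => cutoff n t * p t * k i t :=
    hint ⟨⟨_, hc n⟩, hcs n⟩ i
  have h1 : |∫ t, p t * k i t - cutoff n t * p t * k i t| ≤ δ / (2 * N) * |M| := by
    simp only [← sub_mul]
    exact (abs_integral_mul_le (hk0 i) (hwk i) hn).trans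
      (mul_le_mul_of_nonneg_left ((hM i).trans (le_abs_self M)) (by positivity))
  have h2 : |∫ t, p t - cutoff n t * p t ∂ν| ≤ δ / (2 * N) * W := by
    rw [hW, ← integral_const_mul, ← Real.norm_eq_abs]
    exact norm_integral_le_of_norm_le (hwν.const_mul _) (Eventually.of_forall hn)
  rw [integral_sub (hpk i) hck] at h1
  rw [integral_sub hpν ((hc n).integrable_of_hasCompactSupport (hcs n))] at h2
  have h3 : δ / (2 * N) * |M| + δ / (2 * N) * W + δ / (2 * N) = δ / 2 := by
    rw [hN]; field_simp
  rw [abs_lt] at hi ⊢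
  rw [abs_le] at h1 h2
  constructor <;> linarith

end WeakLimit

/-- Weak compactness for complex densities: if the integrals of `w ‖f i‖` are bounded, then along
any ultrafilter the measures `f i dt` converge to a complex measure when paired with continuous
functions of smaller order than `w`. The positive and negative parts of the real and imaginary
parts of `f i` are treated separately. -/
theorem exists_borelComplexMeasure_tendsto {ι : Type*} (U : Ultrafilter ι) {f : ι → ℝ → ℂ}
    {w : ℝ → ℝ} {M : ℝ} (hw : Continuous w) (hw0 : ∀ t, 0 < w t)
    (hf : ∀ i, AEStronglyMeasurable (f i)) (hwf : ∀ i, Integrable fun t => w t * ‖f i t‖)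
    (hM : ∀ i, ∫ t, w t * ‖f i t‖ ≤ M) :
    ∃ μ : BorelComplexMeasure, ∫⁻ t, ENNReal.ofReal (w t) ∂μ.variation < ∞ ∧
      ∀ p : ℝ → ℝ, Continuous p →
        (∀ ε > 0, ∃ n : ℕ, ∀ t : ℝ, (n : ℝ) ≤ |t| → |p t| ≤ ε * w t) →
        Tendsto (fun i => ∫ t, (p t : ℂ) * f i t) U (𝓝 (μ.integral fun t => (p t : ℂ))) := by
  -- The parts of `z` are `max (re (conj c * z)) 0` for the four units `c`.
  let c : Fin 4 → ℂ := ![1, -1, Complex.I, -Complex.I]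
  have hc1 : ∀ j, ‖c j‖ = 1 := by
    intro j
    fin_cases j <;> simp [c]
  let P : Fin 4 → ℂ → ℝ := fun j z => max (starRingEnd ℂ (c j) * z).re 0
  have hPc : ∀ j, Continuous (P j) := fun j => by fun_prop
  have hP0 : ∀ j z, 0 ≤ P j z := fun j z => le_max_right _ _
  have hPle : ∀ j z, P j z ≤ ‖z‖ := fun j z => by
    refine max_le ((Complex.re_le_norm _).trans ?_) (norm_nonneg _)
    rw [norm_mul, Complex.norm_conj, hc1, one_mul]
  have hsum : ∀ z : ℂ, ∑ j, c j * (P j z : ℂ) = z := fun z => by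
    have h1 : max z.re 0 - max (-z.re) 0 = z.re := max_zero_sub_max_neg_zero_eq_self _
    have h2 : max z.im 0 - max (-z.im) 0 = z.im := max_zero_sub_max_neg_zero_eq_self _
    apply Complex.ext
    · simp [Fin.sum_univ_four, c, P]
      linarith
    · simp [Fin.sum_univ_four, c, P]
      linarith
  have hPm : ∀ j i, AEStronglyMeasurable fun t => P j (f i t) := fun j i =>
    (hPc j).comp_aestronglyMeasurable (hf i)
  have hwP : ∀ j i, Integrable fun t => w t * P j (f i t) := fun j i => by
    refine (hwf i).mono' (hw.aestronglyMeasurable.mul (hPm j i)) (Eventually.of_forall fun t => ?_)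
    rw [Real.norm_of_nonneg (mul_nonneg (hw0 t).le (hP0 _ _))]
    exact mul_le_mul_of_nonneg_left (hPle _ _) (hw0 t).le
  have hMP : ∀ j i, ∫ t, w t * P j (f i t) ≤ M := fun j i =>
    (integral_mono (hwP j i) (hwf i) fun t =>
      mul_le_mul_of_nonneg_left (hPle _ _) (hw0 t).le).trans (hM i)
  choose ν hνfin hνw hν using fun j =>
    exists_measure_tendsto_integral_mul U hw hw0 (hPm j) (fun i t => hP0 j _) (hwP j) (hMP j)
  -- The limit measure is `∑ c j • ν j`, given by its density with respect to `ρ`.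
  set ρ : Measure ℝ := ∑ j, ν j with hρ
  have hwρ : Integrable w ρ := integrable_finsetSum_measure.2 fun j _ => hνw j
  have hwρ' : ∫⁻ t, ENNReal.ofReal (w t) ∂ρ < ∞ :=
    (hasFiniteIntegral_iff_ofReal (Eventually.of_forall fun t => (hw0 t).le)).1 hwρ.2
  have hρfin : IsLocallyFiniteMeasure ρ := isLocallyFiniteMeasure_of_lintegral_lt_top hw hw0 hwρ'
  have hle : ∀ j, ν j ≤ ρ := fun j => by
    rw [hρ, ← Finset.add_sum_erase _ _ (Finset.mem_univ j)]
    exact Measure.le_add_right le_rfl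
  let g : Fin 4 → ℝ → ℝ := fun j t => ((ν j).rnDeriv ρ t).toReal
  have hgm : ∀ j, Measurable (g j) := fun j => (Measure.measurable_rnDeriv _ _).ennreal_toReal
  have hg1 : ∀ j, ∀ᵐ t ∂ρ, ‖g j t‖ ≤ 1 := fun j => by
    filter_upwards [Measure.rnDeriv_le_one_of_le (hle j)] with t ht
    rw [Real.norm_of_nonneg ENNReal.toReal_nonneg]
    exact ENNReal.toReal_le_of_le_ofReal zero_le_one (by simpa using ht)
  let h : ℝ → ℂ := fun t => ∑ j, c j * (g j t : ℂ)
  have hhm : Measurable h := by fun_prop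
  have hh4 : ∀ᵐ t ∂ρ, ‖h t‖ ≤ 4 := by
    filter_upwards [ae_all_iff.2 hg1] with t ht
    refine (norm_sum_le _ _).trans ?_
    calc ∑ j, ‖c j * (g j t : ℂ)‖ ≤ ∑ _j : Fin 4, (1 : ℝ) := by
          refine Finset.sum_le_sum fun j _ => ?_
          rw [norm_mul, hc1, one_mul, Complex.norm_real]
          exact ht j
      _ = 4 := by simp
  have hhl : LocallyIntegrable h ρ := locallyIntegrable_iff.2 fun K hK => by
    have h1 : IntegrableOn (fun _ => (1 : ℂ)) K ρ := integrableOn_const hK.measure_lt_top.ne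
    have := h1.mul_bdd hhm.aestronglyMeasurable.restrict (ae_restrict_of_ae hh4)
    simpa only [one_mul, IntegrableOn] using this
  have H := BorelComplexMeasure.hasDensity_ofDensity hhl hh4
  refine ⟨BorelComplexMeasure.ofDensity ρ h hhl, ?_, fun p hp hpw => ?_⟩
  · obtain ⟨C, hC⟩ := H.exists_variation_le
    refine (lintegral_mono' hC le_rfl).trans_lt ?_
    rw [lintegral_smul_measure]
    exact ENNReal.mul_lt_top ENNReal.coe_lt_top hwρ'
  · have hpρ : Integrable p ρ := integrable_finsetSum_measure.2 fun j _ => (hν j p hp hpw).2.1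
    have hlim : Tendsto (fun i => ∑ j, c j * ((∫ t, p t * P j (f i t) : ℝ) : ℂ)) U
        (𝓝 (∑ j, c j * ((∫ t, p t ∂ν j : ℝ) : ℂ))) :=
      tendsto_finsetSum _ fun j _ => (((Complex.continuous_ofReal.tendsto _).comp
        (hν j p hp hpw).2.2).const_mul (c j))
    have hpP : ∀ j i, Integrable fun t => c j * ((p t * P j (f i t) : ℝ) : ℂ) := fun j i =>
      Integrable.const_mul ((hν j p hp hpw).1 i).ofReal (c j)
    have e1 : ∀ i, ∑ j, c j * ((∫ t, p t * P j (f i t) : ℝ) : ℂ) = ∫ t, (p t : ℂ) * f i t :=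
        fun i => by
      simp only [← integral_complex_ofReal, ← integral_const_mul]
      rw [← integral_finsetSum _ fun j _ => hpP j i]
      refine integral_congr_ae (Eventually.of_forall fun t => ?_)
      simp only
      conv_rhs => rw [← hsum (f i t), Finset.mul_sum]
      refine Finset.sum_congr rfl fun j _ => ?_
      push_cast
      ring
    have hpg : ∀ j, Integrable (fun t => c j * ((p t * g j t : ℝ) : ℂ)) ρ := fun j =>
      Integrable.const_mul (hpρ.mul_bdd (hgm j).aestronglyMeasurable (hg1 j)).ofReal (c j)
    have hpρ' : Integrable (fun t => (p t : ℂ)) ρ := hpρ.ofReal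
    have e2 : ∑ j, c j * ((∫ t, p t ∂ν j : ℝ) : ℂ) =
        (BorelComplexMeasure.ofDensity ρ h hhl).integral fun t => (p t : ℂ) := by
      rw [H.integral_eq hpρ']
      have : ∀ j, ∫ t, p t ∂ν j = ∫ t, p t * g j t ∂ρ := fun j => by
        rw [← integral_toReal_rnDeriv_mul (hle j).absolutelyContinuous]
        simp only [g, mul_comm]
      simp only [this, ← integral_complex_ofReal, ← integral_const_mul]
      rw [← integral_finsetSum _ fun j _ => hpg j]
      refine integral_congr_ae (Eventually.of_forall fun t => ?_)
      simp only [h, Finset.mul_sum]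
      refine Finset.sum_congr rfl fun j _ => ?_
      push_cast
      ring
    rw [← e2]
    exact hlim.congr e1

/-! ### Estimates for functions in the Hardy–Orlicz space -/

open scoped NNReal

theorem IsGrowthFunction.apply_zero {Φ : ℝ → ℝ} (hΦ : IsGrowthFunction Φ) : Φ 0 = 0 := by
  obtain ⟨s, hs, hs0⟩ : (0 : ℝ) ∈ Φ '' Ici 0 := by rw [hΦ.image_eq]; exact self_mem_Ici
  have h0 : (0 : ℝ) ≤ Φ 0 := by
    have : Φ 0 ∈ Φ '' Ici 0 := mem_image_of_mem _ self_mem_Ici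
    rwa [hΦ.image_eq] at this
  exact le_antisymm (hs0 ▸ hΦ.monotoneOn self_mem_Ici hs hs) h0

theorem IsGrowthFunction.nonneg {Φ : ℝ → ℝ} (hΦ : IsGrowthFunction Φ) {t : ℝ} (ht : 0 ≤ t) :
    0 ≤ Φ t :=
  hΦ.apply_zero ▸ hΦ.monotoneOn self_mem_Ici ht ht

/-- A convex growth function dominates a linear function away from zero. -/
theorem IsGrowthFunction.mul_apply_one_le {Φ : ℝ → ℝ} (hΦ : IsGrowthFunction Φ)
    (hconv : ConvexOn ℝ (Ici 0) Φ) {t : ℝ} (ht : 0 ≤ t) : t * Φ 1 ≤ Φ 1 + Φ t := by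
  have h1 := hΦ.nonneg zero_le_one
  rcases le_total t 1 with h | h
  · nlinarith [hΦ.nonneg ht]
  -- For `t ≥ 1`, the point `1` is a convex combination of `t` and `0`, and `Φ 0 = 0`.
  · have h0 : 0 < t := by linarith
    have hinv : t⁻¹ ≤ 1 := inv_le_one_of_one_le₀ h
    have := hconv.2 (show t ∈ Ici (0 : ℝ) from ht) (self_mem_Ici : (0 : ℝ) ∈ Ici (0 : ℝ))
      (inv_nonneg.2 ht) (sub_nonneg.2 hinv) (by ring)
    simp only [smul_eq_mul, mul_zero, add_zero, hΦ.apply_zero, inv_mul_cancel₀ h0.ne'] at this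
    rw [← div_eq_inv_mul, le_div_iff₀ h0] at this
    linarith

namespace MemHardyOrlicz

variable {Φ : ℝ → ℝ} {F : ℂ → ℂ}

/-- A single constant above the supremum of the Luxemburg norms serves for all horizontal lines. -/
theorem exists_lintegral_le_one (hΦ : IsGrowthFunction Φ) (hF : MemHardyOrlicz Φ F) :
    ∃ C : ℝ, 0 < C ∧ ∀ y : ℝ, 0 < y →
      ∫⁻ x : ℝ, ENNReal.ofReal (Φ (‖F (x + y * Complex.I)‖ / C)) ≤ 1 := by
  obtain ⟨C, hC, -⟩ := ENNReal.lt_iff_exists_nnreal_btwn.1 hF.bounded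
  have hC0 : (0 : ℝ) < C := by
    have : (0 : ℝ≥0∞) < C := bot_le.trans_lt hC
    exact_mod_cast this
  refine ⟨C, hC0, fun y hy => ?_⟩
  have hlt : luxemburgNorm Φ (fun x : ℝ => F (x + y * Complex.I)) < C :=
    (le_iSup₂ (f := fun (y : ℝ) (_ : 0 < y) =>
      luxemburgNorm Φ (fun x : ℝ => F (x + y * Complex.I))) y hy).trans_lt hC
  unfold luxemburgNorm at hlt
  obtain ⟨l, hl⟩ := iInf_lt_iff.1 hlt
  obtain ⟨hl0, hl⟩ := iInf_lt_iff.1 hl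
  obtain ⟨hle, hlC⟩ := iInf_lt_iff.1 hl
  have hlC' : l ≤ C := by
    rw [← ENNReal.ofReal_coe_nnreal, ENNReal.ofReal_lt_ofReal_iff hC0] at hlC
    exact hlC.le
  refine (lintegral_mono fun x => ENNReal.ofReal_le_ofReal ?_).trans hle
  refine hΦ.monotoneOn (show (0 : ℝ) ≤ _ by positivity) (show (0 : ℝ) ≤ _ by positivity) ?_
  gcongr

/-- The restrictions of `F` to horizontal lines satisfy a uniform `L¹` estimate against weights
that are bounded by one and integrable. -/
theorem exists_lintegral_mul_enorm_le (hΦ : IsGrowthFunction Φ) (hconv : ConvexOn ℝ (Ici 0) Φ)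
    (hpos : ∀ t : ℝ, 0 < t → 0 < Φ t) (hF : MemHardyOrlicz Φ F) :
    ∃ A : ℝ≥0, ∀ y : ℝ, 0 < y → ∀ w : ℝ → ℝ≥0∞, Measurable w → (∀ t, w t ≤ 1) →
      ∫⁻ x : ℝ, w x * ‖F (x + y * Complex.I)‖ₑ ≤ A * ((∫⁻ x, w x) + 1) := by
  obtain ⟨C, hC0, hC⟩ := hF.exists_lintegral_le_one hΦ
  have h1 := hpos 1 one_pos
  set A : ℝ := C + C / Φ 1 with hA
  have hA0 : 0 ≤ A := by positivity
  refine ⟨A.toNNReal, fun y hy w hw hw1 => ?_⟩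
  have hpt : ∀ x : ℝ, ‖F (x + y * Complex.I)‖ₑ ≤
      A.toNNReal * (1 + ENNReal.ofReal (Φ (‖F (x + y * Complex.I)‖ / C))) := fun x => by
    set r := ‖F (x + y * Complex.I)‖ / C with hr
    have hr0 : 0 ≤ r := by positivity
    have h2 := hΦ.mul_apply_one_le hconv hr0
    have h3 := hΦ.nonneg hr0
    have h4 : ‖F (x + y * Complex.I)‖ ≤ A * (1 + Φ r) := by
      have e : ‖F (x + y * Complex.I)‖ = C * r := by rw [hr]; field_simp
      have h5 : r ≤ 1 + Φ r / Φ 1 := by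
        rw [← mul_le_mul_iff_left₀ h1, add_mul, div_mul_cancel₀ _ h1.ne']
        linarith
      have h6 : 0 ≤ C * Φ r := by positivity
      have h7 : 0 ≤ C / Φ 1 := by positivity
      calc _ = C * r := e
        _ ≤ C * (1 + Φ r / Φ 1) := by gcongr
        _ = C + C / Φ 1 * Φ r := by ring
        _ ≤ A * (1 + Φ r) := by rw [hA]; linarith
    rw [← ofReal_norm, ← ENNReal.ofReal_one, ← ENNReal.ofReal_add zero_le_one h3]
    calc ENNReal.ofReal ‖F (x + y * Complex.I)‖ ≤ ENNReal.ofReal (A * (1 + Φ r)) :=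
          ENNReal.ofReal_le_ofReal h4
      _ = _ := ENNReal.ofReal_mul hA0
  calc ∫⁻ x : ℝ, w x * ‖F (x + y * Complex.I)‖ₑ
      ≤ ∫⁻ x : ℝ, A.toNNReal * (w x + ENNReal.ofReal (Φ (‖F (x + y * Complex.I)‖ / C))) := by
        refine lintegral_mono fun x => ?_
        calc w x * ‖F (x + y * Complex.I)‖ₑ
            ≤ w x * (A.toNNReal * (1 + ENNReal.ofReal (Φ (‖F (x + y * Complex.I)‖ / C)))) := by
              gcongr
              exact hpt x
          _ = A.toNNReal * (w x + w x * ENNReal.ofReal (Φ (‖F (x + y * Complex.I)‖ / C))) := by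
              ring
          _ ≤ _ := by
              gcongr
              exact mul_le_of_le_one_left zero_le (hw1 x)
    _ = A.toNNReal * ((∫⁻ x, w x) +
          ∫⁻ x : ℝ, ENNReal.ofReal (Φ (‖F (x + y * Complex.I)‖ / C))) := by
        rw [lintegral_const_mul' _ _ ENNReal.coe_ne_top, lintegral_add_left hw]
    _ ≤ _ := by
        gcongr
        exact hC y hy

end MemHardyOrlicz

theorem ContinuousOn.measurable_indicator_enorm {F : ℂ → ℂ} {s : Set ℂ} (hF : ContinuousOn F s)
    (hs : MeasurableSet s) : Measurable (s.indicator fun z => ‖F z‖ₑ) := by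
  classical
  rw [← piecewise_eq_indicator]
  exact hF.enorm.measurable_piecewise continuousOn_const hs

open InnerProductSpace in
/-- The area form of the mean value inequality, up to a constant. -/
theorem enorm_le_lintegral_ball {F : ℂ → ℂ} {c : ℂ} {r : ℝ} (hr : 0 < r)
    (hF : HarmonicOnNhd F (Metric.closedBall c r)) :
    ENNReal.ofReal (r / 2) * ENNReal.ofReal (r / 2) * ‖F c‖ₑ ≤
      ∫⁻ z in Metric.ball c r, ‖F z‖ₑ := by
  have hcirc : ∀ s ∈ Ioo (r / 2) r, ‖F c‖ₑ ≤
      ∫⁻ θ in Ioo (-Real.pi) Real.pi, ‖F (circleMap c s θ)‖ₑ := fun s hs => by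
    have hs0 : 0 < s := by linarith [hs.1]
    have h1 : Real.circleAverage F c s = F c := by
      refine InnerProductSpace.HarmonicOnNhd.circleAverage_eq fun z hz => hF z ?_
      rw [abs_of_pos hs0] at hz
      exact Metric.closedBall_subset_closedBall hs.2.le hz
    rw [Real.circleAverage_eq_integral_add (-Real.pi),
      intervalIntegral.integral_comp_add_right (fun θ => F (circleMap c s θ)),
      show 2 * Real.pi + -Real.pi = Real.pi by ring, zero_add,
      intervalIntegral.integral_of_le (by linarith [Real.pi_pos]), integral_Ioc_eq_integral_Ioo] at h1
    rw [← h1, enorm_smul]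
    calc _ ≤ 1 * ‖∫ θ in Ioo (-Real.pi) Real.pi, F (circleMap c s θ)‖ₑ := by
          gcongr
          rw [← ofReal_norm, Real.norm_of_nonneg (by positivity)]
          refine ENNReal.ofReal_le_one.2 (inv_le_one_of_one_le₀ ?_)
          linarith [Real.pi_gt_three]
      _ ≤ _ := by
          rw [one_mul]
          exact enorm_integral_le_lintegral_enorm _
  -- Only the part `r / 2 < |z - c| < r` of the disc is used.
  set G : ℂ → ℝ≥0∞ := (Metric.ball c r).indicator fun z => ‖F z‖ₑ with hG
  have hGm : Measurable G :=
    (hF.continuousOn.mono Metric.ball_subset_closedBall).measurable_indicator_enorm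
      measurableSet_ball
  calc ENNReal.ofReal (r / 2) * ENNReal.ofReal (r / 2) * ‖F c‖ₑ
      = ∫⁻ _ in Ioo (r / 2) r, ENNReal.ofReal (r / 2) * ‖F c‖ₑ := by
        rw [setLIntegral_const, Real.volume_Ioo, show r - r / 2 = r / 2 by ring]
        ring
    _ ≤ ∫⁻ s in Ioo (r / 2) r, ∫⁻ θ in Ioo (-Real.pi) Real.pi,
          ENNReal.ofReal s * G (circleMap c s θ) := by
        refine setLIntegral_mono' measurableSet_Ioo fun s hs => ?_
        rw [lintegral_const_mul' _ _ ENNReal.ofReal_ne_top]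
        gcongr
        · exact hs.1.le
        · refine (hcirc s hs).trans (le_of_eq ?_)
          congr 1
          ext θ
          rw [hG, indicator_of_mem]
          rw [Metric.mem_ball, dist_eq_norm, circleMap_sub_center, norm_circleMap_zero,
            abs_of_pos (by linarith [hs.1])]
          exact hs.2
    _ ≤ ∫⁻ s in Ioi 0, ∫⁻ θ in Ioo (-Real.pi) Real.pi,
          ENNReal.ofReal s * G (circleMap c s θ) :=
        lintegral_mono_set fun s hs => show (0 : ℝ) < s by linarith [hs.1]
    _ = ∫⁻ p in polarCoord.target, ENNReal.ofReal p.1 • G (c + Complex.polarCoord.symm p) := by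
        have : polarCoord.target = Ioi (0 : ℝ) ×ˢ Ioo (-Real.pi) Real.pi := rfl
        rw [this, Measure.volume_eq_prod, ← Measure.prod_restrict, lintegral_prod]
        · simp only [Complex.polarCoord_symm_apply, circleMap, smul_eq_mul, Complex.exp_mul_I,
            Complex.ofReal_cos, Complex.ofReal_sin]
        · refine Measurable.aemeasurable ?_
          simp only [Complex.polarCoord_symm_apply]
          fun_prop
    _ = ∫⁻ z, G (c + z) := Complex.lintegral_comp_polarCoord_symm fun z => G (c + z)
    _ = ∫⁻ z, G z := lintegral_add_left_eq_self _ _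
    _ = ∫⁻ z in Metric.ball c r, ‖F z‖ₑ := lintegral_indicator measurableSet_ball _

namespace MemHardyOrlicz

variable {Φ : ℝ → ℝ} {F : ℂ → ℂ}

/-- Functions in the Hardy–Orlicz space are bounded on smaller half-planes: the uniform `L¹`
estimate on horizontal lines bounds their means over discs. -/
theorem exists_norm_le (hΦ : IsGrowthFunction Φ) (hconv : ConvexOn ℝ (Ici 0) Φ)
    (hpos : ∀ t : ℝ, 0 < t → 0 < Φ t) (hF : MemHardyOrlicz Φ F) {ε : ℝ} (hε : 0 < ε) :
    ∃ K : ℝ, ∀ z : ℂ, ε ≤ z.im → ‖F z‖ ≤ K := by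
  obtain ⟨A, hA⟩ := hF.exists_lintegral_mul_enorm_le hΦ hconv hpos
  -- The disc of radius `ε / 2` around a point at height at least `ε` stays in the half-plane.
  set r := ε / 2 with hr
  have hr0 : 0 < r := by positivity
  set c := ENNReal.ofReal (r / 2) * ENNReal.ofReal (r / 2) with hc
  set B : ℝ≥0∞ := A * (ENNReal.ofReal (2 * r) + 1) * ENNReal.ofReal (2 * r) with hB
  have hc0 : c ≠ 0 := by
    have : ENNReal.ofReal (r / 2) ≠ 0 := by simpa using hr0
    exact mul_ne_zero this this
  have hctop : c ≠ ∞ := by finiteness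
  have hBtop : B / c ≠ ∞ := by finiteness
  refine ⟨(B / c).toReal, fun z hz => ?_⟩
  have hharm : InnerProductSpace.HarmonicOnNhd F (Metric.closedBall z r) := fun u hu => by
    refine hF.harmonic u ?_
    have h1 := Complex.abs_im_le_norm (u - z)
    rw [Metric.mem_closedBall, dist_eq_norm] at hu
    have h2 := neg_le_of_abs_le (h1.trans hu)
    rw [Complex.sub_im] at h2
    change 0 < u.im
    linarith
  have h1 := enorm_le_lintegral_ball hr0 hharm
  have h2 : ∫⁻ u in Metric.ball z r, ‖F u‖ₑ ≤ B := by
    -- Slice the disc by horizontal lines, and enlarge it to the square `I × J`.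
    set G : ℂ → ℝ≥0∞ := (Metric.ball z r).indicator fun u => ‖F u‖ₑ with hG
    have hGm : Measurable G :=
      (hharm.continuousOn.mono Metric.ball_subset_closedBall).measurable_indicator_enorm
        measurableSet_ball
    set I : Set ℝ := Icc (z.re - r) (z.re + r)
    set J : Set ℝ := Icc (z.im - r) (z.im + r)
    have hI : ∫⁻ a, I.indicator (1 : ℝ → ℝ≥0∞) a = ENNReal.ofReal (2 * r) := by
      rw [lintegral_indicator_one measurableSet_Icc, Real.volume_Icc]
      congr 1
      ring
    have hpt : ∀ a b : ℝ, G (a + b * Complex.I) ≤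
        J.indicator (fun b => I.indicator 1 a * ‖F (a + b * Complex.I)‖ₑ) b := fun a b => by
      by_cases hu : (a + b * Complex.I : ℂ) ∈ Metric.ball z r
      · rw [hG, indicator_of_mem hu]
        rw [Metric.mem_ball, dist_eq_norm] at hu
        have ha := abs_le.1 ((Complex.abs_re_le_norm _).trans hu.le)
        have hb := abs_le.1 ((Complex.abs_im_le_norm _).trans hu.le)
        simp only [Complex.sub_re, Complex.sub_im, Complex.add_re, Complex.add_im,
          Complex.ofReal_re, Complex.ofReal_im, Complex.re_ofReal_mul, Complex.im_ofReal_mul,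
          Complex.I_re, Complex.I_im, mul_zero, add_zero, mul_one, zero_add] at ha hb
        have ha' : a ∈ I := ⟨by linarith [ha.1], by linarith [ha.2]⟩
        have hb' : b ∈ J := ⟨by linarith [hb.1], by linarith [hb.2]⟩
        rw [indicator_of_mem hb', indicator_of_mem ha', Pi.one_apply, one_mul]
      · rw [hG, indicator_of_notMem hu]
        exact zero_le
    calc ∫⁻ u in Metric.ball z r, ‖F u‖ₑ = ∫⁻ u, G u :=
          (lintegral_indicator measurableSet_ball _).symm
      _ = ∫⁻ p : ℝ × ℝ, G (p.1 + p.2 * Complex.I) := by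
          rw [← Complex.volume_preserving_equiv_real_prod.symm.lintegral_comp hGm]
          simp [Complex.measurableEquivRealProd_symm_apply, Complex.mk_eq_add_mul_I]
      _ = ∫⁻ b : ℝ, ∫⁻ a : ℝ, G (a + b * Complex.I) := by
          rw [Measure.volume_eq_prod, lintegral_prod_symm]
          exact Measurable.aemeasurable (by fun_prop)
      _ ≤ ∫⁻ b : ℝ, J.indicator (fun _ => A * (ENNReal.ofReal (2 * r) + 1)) b := by
          refine lintegral_mono fun b => ?_
          by_cases hb : b ∈ J
          · rw [indicator_of_mem hb, ← hI]
            refine le_trans (lintegral_mono fun a => ?_) (hA b (by linarith [hb.1]) _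
              (measurable_one.indicator measurableSet_Icc) fun t => ?_)
            · simpa only [indicator_of_mem hb] using hpt a b
            · exact indicator_le_self' (fun _ _ => zero_le) t
          · refine (lintegral_mono fun a => hpt a b).trans ?_
            simp only [indicator_of_notMem hb, lintegral_zero, le_refl]
      _ = B := by
          rw [lintegral_indicator_const measurableSet_Icc, Real.volume_Icc, hB]
          congr 2
          ring
  have h3 : ‖F z‖ₑ ≤ B / c := by
    rw [ENNReal.le_div_iff_mul_le (Or.inl hc0) (Or.inl hctop), mul_comm]
    exact h1.trans h2
  rw [← toReal_enorm]
  exact ENNReal.toReal_mono hBtop h3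

end MemHardyOrlicz

/-! ### The representing measure -/

open Laplacian in
theorem InnerProductSpace.HarmonicAt.comp_add_right {F : ℂ → ℂ} {z a : ℂ}
    (hF : InnerProductSpace.HarmonicAt F (z + a)) :
    InnerProductSpace.HarmonicAt (fun u => F (u + a)) z := by
  have ht : Tendsto (fun u : ℂ => u + a) (𝓝 z) (𝓝 (z + a)) :=
    (continuous_id.add continuous_const).tendsto z
  have hΔ : Δ (fun u => F (u + a)) = fun u => Δ F (u + a) := by
    simp only [laplacian_eq_iteratedFDeriv_complexPlane, iteratedFDeriv_comp_add_right']
  refine ⟨hF.1.comp z (contDiffAt_id.add contDiffAt_const), ?_⟩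
  rw [hΔ]
  exact ht.eventually hF.2

theorem Complex.harmonicOnNhd_comp_add_mul_I {F : ℂ → ℂ}
    (hF : InnerProductSpace.HarmonicOnNhd F {z : ℂ | 0 < z.im}) {ε : ℝ} (hε : 0 < ε) :
    InnerProductSpace.HarmonicOnNhd (fun z => F (z + ε * Complex.I)) {z : ℂ | 0 ≤ z.im} := by
  refine fun z hz => (hF _ ?_).comp_add_right
  have hz' : 0 ≤ z.im := hz
  change 0 < (z + ε * Complex.I).im
  simp only [Complex.add_im, Complex.im_ofReal_mul, Complex.I_im]
  linarith

/-- A bounded complex harmonic function on a neighbourhood of the closed upper half-plane is the Poisson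
integral of its boundary values. -/
theorem eq_integral_ofReal_halfPlaneKernel_mul {G : ℂ → ℂ}
    (hG : InnerProductSpace.HarmonicOnNhd G {z : ℂ | 0 ≤ z.im}) {K : ℝ}
    (hK : ∀ z : ℂ, 0 ≤ z.im → ‖G z‖ ≤ K) (x : ℝ) {y : ℝ} (hy : 0 < y) :
    G (x + y * Complex.I) =
      1 / (Real.pi : ℂ) * ∫ t : ℝ, (halfPlaneKernel x y t : ℂ) * G t := by
  have hre := eq_integral_halfPlaneKernel_mul (hG.comp_CLM Complex.reCLM)
    (fun z hz => (Complex.abs_re_le_norm _).trans (hK z hz)) x hy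
  have him := eq_integral_halfPlaneKernel_mul (hG.comp_CLM Complex.imCLM)
    (fun z hz => (Complex.abs_im_le_norm _).trans (hK z hz)) x hy
  have hker : Integrable fun t => (halfPlaneKernel x y t : ℂ) := by
    refine integrable_halfPlaneKernel ?_ x hy
    have h := integrable_inv_one_add_sq.lintegral_lt_top
    simpa only [one_div] using h
  have hGc : Continuous fun t : ℝ => G t :=
    hG.continuousOn.comp_continuous Complex.continuous_ofReal fun t => by simp
  have hint : Integrable fun t : ℝ => (halfPlaneKernel x y t : ℂ) * G t :=
    hker.mul_bdd hGc.aestronglyMeasurable (Eventually.of_forall fun t => hK t (by simp))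
  have hpi : (1 / (Real.pi : ℂ)) = ((1 / Real.pi : ℝ) : ℂ) := by push_cast; rfl
  rw [hpi]
  apply Complex.ext
  · rw [Complex.re_ofReal_mul]
    refine hre.trans ?_
    congr 1
    refine Eq.trans (integral_congr_ae (Eventually.of_forall fun t => ?_)) (integral_re hint)
    exact (Complex.re_ofReal_mul _ _).symm
  · rw [Complex.im_ofReal_mul]
    refine him.trans ?_
    congr 1
    refine Eq.trans (integral_congr_ae (Eventually.of_forall fun t => ?_)) (integral_im hint)
    exact (Complex.im_ofReal_mul _ _).symm

/-- The Poisson decay `1 / (1 + t ^ 2)` is faster than that of the integrable weight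
`(1 + ‖t‖) ^ (-3 / 2)`. -/
theorem one_div_one_add_sq_le (t : ℝ) :
    1 / (1 + t ^ 2) ≤ 2 * (1 + ‖t‖) ^ (-(1 / 2) : ℝ) * (1 + ‖t‖) ^ (-(3 / 2) : ℝ) := by
  have h0 : 0 < 1 + ‖t‖ := by positivity
  rw [mul_assoc, ← Real.rpow_add h0, show (-(1 / 2) : ℝ) + -(3 / 2) = -(2 : ℕ) by norm_num,
    Real.rpow_neg h0.le, Real.rpow_natCast, Real.norm_eq_abs, ← div_eq_mul_inv,
    div_le_div_iff₀ (by positivity) (by positivity)]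
  nlinarith [sq_nonneg (1 - |t|), sq_abs t]

/-- The measures `F(t + iε) dt` represent the translates of `F`; a weak limit of them as `ε → 0`
represents `F`. -/
theorem MemHardyOrlicz.exists_isPoissonIntegralOf {Φ : ℝ → ℝ} {F : ℂ → ℂ}
    (hΦ : IsGrowthFunction Φ) (hconv : ConvexOn ℝ (Ici 0) Φ)
    (hpos : ∀ t : ℝ, 0 < t → 0 < Φ t) (hF : MemHardyOrlicz Φ F) :
    ∃ μ : BorelComplexMeasure, IsPoissonIntegralOf F μ := by
  obtain ⟨A, hA⟩ := hF.exists_lintegral_mul_enorm_le hΦ hconv hpos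
  -- The weight is integrable, and of larger order than the Poisson kernel.
  set w : ℝ → ℝ := fun t => (1 + ‖t‖) ^ (-(3 / 2) : ℝ) with hwdef
  have hbase : ∀ t : ℝ, 0 < 1 + ‖t‖ := fun t => by positivity
  have hw : Continuous w :=
    (continuous_const.add continuous_norm).rpow_const fun t => Or.inl (hbase t).ne'
  have hw0 : ∀ t, 0 < w t := fun t => Real.rpow_pos_of_pos (hbase t) _
  have hw1 : ∀ t, w t ≤ 1 := fun t =>
    Real.rpow_le_one_of_one_le_of_nonpos (by simp) (by norm_num)
  have hwi : Integrable w := integrable_one_add_norm (by simp; norm_num)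
  let ι := {ε : ℝ // 0 < ε}
  have hne : NeBot (comap (Subtype.val : ι → ℝ) (𝓝[>] 0)) := by
    refine comap_neBot_iff_frequently.2 (Eventually.frequently ?_)
    filter_upwards [self_mem_nhdsWithin] with ε hε using ⟨⟨ε, hε⟩, rfl⟩
  -- An ultrafilter along which `ε → 0` replaces the choice of a weakly convergent subsequence.
  let U : Ultrafilter ι := Ultrafilter.of (comap Subtype.val (𝓝[>] 0))
  have hU : Tendsto (Subtype.val : ι → ℝ) U (𝓝 0) :=
    (tendsto_comap.mono_left (Ultrafilter.of_le _)).mono_right nhdsWithin_le_nhds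
  have hFc : ∀ {z : ℂ}, 0 < z.im → ContinuousAt F z := fun {z} hz =>
    (hF.harmonic z hz).1.continuousAt
  let f : ι → ℝ → ℂ := fun ε t => F (t + (ε : ℝ) * Complex.I)
  have hfc : ∀ ε, Continuous (f ε) := fun ε => continuous_iff_continuousAt.2 fun t =>
    ContinuousAt.comp (f := fun t : ℝ => (t : ℂ) + (ε : ℝ) * Complex.I)
      (hFc (by simpa using ε.2)) (by fun_prop)
  -- The bound on horizontal lines, applied with the weight `w`.
  have hfw : ∀ ε, ∫⁻ t, ‖w t * ‖f ε t‖‖ₑ ≤ A * ((∫⁻ t, ENNReal.ofReal (w t)) + 1) := fun ε => by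
    refine le_of_eq_of_le (lintegral_congr fun t => ?_) (hA ε ε.2 (fun t => ENNReal.ofReal (w t))
      hw.measurable.ennreal_ofReal fun t => ENNReal.ofReal_le_one.2 (hw1 t))
    rw [enorm_mul, enorm_norm, Real.enorm_of_nonneg (hw0 t).le]
  have htop : A * ((∫⁻ t, ENNReal.ofReal (w t)) + 1) ≠ ∞ := by
    have := hwi.lintegral_lt_top.ne
    finiteness
  have hwf : ∀ ε, Integrable fun t => w t * ‖f ε t‖ := fun ε =>
    ⟨(hw.mul (hfc ε).norm).aestronglyMeasurable, (hfw ε).trans_lt htop.lt_top⟩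
  obtain ⟨μ, hμ, hlim⟩ := exists_borelComplexMeasure_tendsto U hw hw0
    (fun ε => (hfc ε).aestronglyMeasurable) hwf
    (M := (A * ((∫⁻ t, ENNReal.ofReal (w t)) + 1)).toReal) fun ε => by
      rw [integral_eq_lintegral_of_nonneg_ae
        (Eventually.of_forall fun t => mul_nonneg (hw0 t).le (norm_nonneg _))
        (hwf ε).aestronglyMeasurable]
      refine ENNReal.toReal_mono htop (le_of_eq_of_le (lintegral_congr fun t => ?_) (hfw ε))
      rw [Real.enorm_of_nonneg (mul_nonneg (hw0 t).le (norm_nonneg _))]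
  refine ⟨μ, ?_, fun x y hy => ?_⟩
  · calc ∫⁻ t : ℝ, ENNReal.ofReal (1 / (1 + t ^ 2)) ∂μ.variation
        ≤ ∫⁻ t : ℝ, 2 * ENNReal.ofReal (w t) ∂μ.variation := by
          refine lintegral_mono fun t => ?_
          rw [← ENNReal.ofReal_ofNat 2, ← ENNReal.ofReal_mul (by norm_num)]
          refine ENNReal.ofReal_le_ofReal ((one_div_one_add_sq_le t).trans ?_)
          refine mul_le_mul_of_nonneg_right ?_ (hw0 t).le
          have : (1 + ‖t‖) ^ (-(1 / 2) : ℝ) ≤ 1 :=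
            Real.rpow_le_one_of_one_le_of_nonpos (by simp) (by norm_num)
          linarith
      _ < ∞ := by
          rw [lintegral_const_mul' _ _ (by finiteness)]
          exact ENNReal.mul_lt_top (by finiteness) hμ
  · have hk : Continuous (halfPlaneKernel x y) :=
      (continuous_halfPlaneKernel hy).comp (Continuous.prodMk_right x)
    have hdecay : ∀ δ > 0, ∃ n : ℕ, ∀ t : ℝ, (n : ℝ) ≤ |t| →
        |halfPlaneKernel x y t| ≤ δ * w t := fun δ hδ => by
      set D := y * (2 + (1 + 2 * |x| ^ 2) / y ^ 2) with hD
      have hD0 : 0 ≤ D := by positivity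
      have h0 : Tendsto (fun s : ℝ => D * (2 * (1 + s) ^ (-(1 / 2) : ℝ))) atTop (𝓝 0) := by
        have h1 := (tendsto_rpow_neg_atTop (y := 1 / 2) (by norm_num)).comp
          (tendsto_atTop_add_const_left atTop (1 : ℝ) tendsto_id)
        simpa using (h1.const_mul 2).const_mul D
      obtain ⟨a, ha⟩ := eventually_atTop.1 (h0.eventually_le_const hδ)
      refine ⟨⌈a⌉₊, fun t ht => ?_⟩
      rw [abs_of_nonneg (halfPlaneKernel_nonneg x hy t)]
      calc halfPlaneKernel x y t ≤ D * (1 / (1 + t ^ 2)) := halfPlaneKernel_le hy le_rfl t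
        _ ≤ D * (2 * (1 + ‖t‖) ^ (-(1 / 2) : ℝ) * w t) := by
            gcongr
            exact one_div_one_add_sq_le t
        _ = D * (2 * (1 + |t|) ^ (-(1 / 2) : ℝ)) * w t := by rw [Real.norm_eq_abs]; ring
        _ ≤ δ * w t := mul_le_mul_of_nonneg_right (ha _ ((Nat.le_ceil a).trans ht)) (hw0 t).le
    have h1 := (hlim _ hk hdecay).const_mul (1 / (Real.pi : ℂ))
    have h2 : ∀ ε : ι, F (x + y * Complex.I + (ε : ℝ) * Complex.I) =
        1 / (Real.pi : ℂ) * ∫ t, (halfPlaneKernel x y t : ℂ) * f ε t := fun ε => by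
      obtain ⟨K, hK⟩ := hF.exists_norm_le hΦ hconv hpos ε.2
      refine eq_integral_ofReal_halfPlaneKernel_mul
        (G := fun z => F (z + (ε : ℝ) * Complex.I))
        (Complex.harmonicOnNhd_comp_add_mul_I hF.harmonic ε.2) (K := K) (fun z hz => hK _ ?_) x hy
      simpa using hz
    have h3 : Tendsto (fun ε : ι => F (x + y * Complex.I + (ε : ℝ) * Complex.I)) U
        (𝓝 (F (x + y * Complex.I))) := by
      refine Tendsto.comp (hFc (by simpa using hy)) ?_
      have h4 := (Complex.continuous_ofReal.tendsto 0).comp hU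
      simpa using (h4.mul_const Complex.I).const_add (x + y * Complex.I : ℂ)
    exact tendsto_nhds_unique (h3.congr h2) h1

theorem mainTheorem2 (Φ : ℝ → ℝ) (hΦ : IsGrowthFunction Φ) (hconv : ConvexOn ℝ (Ici 0) Φ)
    (hpos : ∀ t : ℝ, 0 < t → 0 < Φ t) (F : ℂ → ℂ) (hF : MemHardyOrlicz Φ F) :
    (∃! μ : BorelComplexMeasure, IsPoissonIntegralOf F μ) ∧
    ∀ μ : BorelComplexMeasure, IsPoissonIntegralOf F μ →
      ∀ φ : ℝ → ℂ, Continuous φ → HasCompactSupport φ →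
        Tendsto (fun y : ℝ => ∫ x : ℝ, φ x * F (x + y * Complex.I)) (𝓝[>] 0)
          (𝓝 (μ.integral φ)) := by
  obtain ⟨μ, hμ⟩ := hF.exists_isPoissonIntegralOf hΦ hconv hpos
  exact ⟨⟨μ, hμ, fun ν hν => hν.unique hμ⟩, fun ν hν φ hφ hφs => hν.tendsto_integral_mul hφ hφs⟩
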